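/- Let $(R,\mathfrak m)$ be an Artinian local (commutative) ring with residue field $\mathbf k=R/\mathfrak m$, let $\mathbf D^b(R)$ and $\mathbf D^b(\mathbf k)$ be the bounded derived categories of finitely generated modules, and let $j_*\colon \mathbf D^b(\mathbf k)\to \mathbf D^b(R)$ be the exact functor induced by $j\colon \operatorname{Spec}\mathbf k\to\operatorname{Spec}R$ (restriction of scalars along $R\to\mathbf k$). For a triangulated category $\mathbf D$, let $\operatorname{Stab}(\mathbf D)$ be the set of locally finite stability conditions $\sigma=(Z,\mathcal P)$ on $\mathbf D$ in the sense of Bridgeland, where $Z\colon K_0(\mathbf D)\to\mathbb C$ is the central charge and $\mathcal P=\{\mathcal P(\phi)\}_{\phi\in\mathbb R}$ is the slicing. Give it Bridgeland's topology: it is generated by the sets $$B_\varepsilon(Z,\mathcal P)=\{(W,\mathcal Q) : \|W-Z\|_{(Z,\mathcal P)}<\sin(\pi\varepsilon),\ d(\mathcal P,\mathcal Q)<\varepsilon\},\qquad 0<\varepsilon<\tfrac18,$$ where $\|U\|_{(Z,\mathcal P)}=\sup\{|U(E)|/|Z(E)| : 0\neq E \text{ semistable}\}$ and $d(\mathcal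 P,\mathcal Q)=\sup_{E\neq0}\max(|\phi^+_{\mathcal P}(E)-\phi^+_{\mathcal Q}(E)|,|\phi^-_{\mathcal P}(E)-\phi^-_{\mathcal Q}(E)|)$, with $\phi^\pm$ the largest and smallest phases of the Harder–Narasimhan factors. For an exact functor $F\colon\mathbf D\to\mathbf D'$ such that $\operatorname{Hom}(Fa,Fb)=0$ implies $\operatorname{Hom}(a,b)=0$, and $\sigma'=(Z',\mathcal P')\in\operatorname{Stab}(\mathbf D')$, let $F^{-1}\sigma'$ be the pair consisting of $Z'\circ F$ and $\phi\mapsto\{x\in\mathbf D : F(x)\in\mathcal P'(\phi)\}$, and let $\operatorname{Dom}F$ be the set of $\sigma'$ with $F^{-1}\sigma'\in\operatorname{Stab}(\mathbf D)$. Then: 1. The object $\mathbf k\in\mathbf D^b(R)$ is $\sigma$-stable (a simple object of some $\mathcal P(\phi)$) for every $\sigma\in\operatorname{Stab}(\mathbf D^b(R))$. 2. $\operatorname{Stab}(\mathbf D^b(R))$ is non-empty. 3. $\operatorname{Hom}(j_*a,j_*b)=0$ implies $\operatorname{Hom}(a,b)=0$ for all $a,b\in\mathbf D^b(\mathbf k)$,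 and $\operatorname{Dom}(j_*)=\operatorname{Stab}(\mathbf D^b(R))$. 4. For $\mathbf D=\mathbf D^b(R)$ and $\mathbf D=\mathbf D^b(\mathbf k)$ the complex vector space $\operatorname{Hom}(K_0(\mathbf D),\mathbb C)$ is finite-dimensional and $(Z,\mathcal P)\mapsto Z$ is a local homeomorphism $\operatorname{Stab}(\mathbf D)\to\operatorname{Hom}(K_0(\mathbf D),\mathbb C)$; give $\operatorname{Stab}(\mathbf D)$ the resulting structure of a complex manifold. The map $$j_*^{-1}\colon\operatorname{Stab}(\mathbf D^b(R))\to\operatorname{Stab}(\mathbf D^b(\mathbf k))$$ is a homeomorphism, and it is biholomorphic for these complex structures. -/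

import Mathlib

open CategoryTheory CategoryTheory.Limits CategoryTheory.Pretriangulated
open scoped ENNReal Manifold ContDiff

universe w w' u v₁ v₂ u₁ u₂

noncomputable section

namespace Stability

/-! ### Grothendieck groups of triangulated categories -/

section Triangulated

variable (D : Type u₁) [Category.{v₁} D] [Preadditive D] [HasZeroObject D] [HasShift D ℤ]
  [∀ n : ℤ, (shiftFunctor D n).Additive] [Pretriangulated D]
  {D' : Type u₂} [Category.{v₂} D'] [Preadditive D'] [HasZeroObject D'] [HasShift D' ℤ]
  [∀ n : ℤ, (shiftFunctor D' n).Additive] [Pretriangulated D']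

/-- The relations `[B] = [A] + [C]`, one for every distinguished triangle `A ⟶ B ⟶ C ⟶ A⟦1⟧`. -/
def K0Relations : AddSubgroup (FreeAbelianGroup D) :=
  AddSubgroup.closure
    { x | ∃ T : Triangle D, T ∈ distTriang D ∧
      x = FreeAbelianGroup.of T.obj₂ - FreeAbelianGroup.of T.obj₁ - FreeAbelianGroup.of T.obj₃ }

/-- The Grothendieck group of a triangulated category. -/
abbrev K0 : Type u₁ := FreeAbelianGroup D ⧸ K0Relations D

variable {D}

/-- The class of an object in the Grothendieck group. -/
def K0.cls (E : D) : K0 D := QuotientAddGroup.mk (FreeAbelianGroup.of E)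

/-- The homomorphism of Grothendieck groups induced by an exact functor. -/
def K0.map (F : D ⥤ D') [F.CommShift ℤ] [F.IsTriangulated] : K0 D →+ K0 D' :=
  QuotientAddGroup.map (K0Relations D) (K0Relations D') (FreeAbelianGroup.map F.obj) (by
    rw [K0Relations, AddSubgroup.closure_le]
    rintro x ⟨T, hT, rfl⟩
    refine AddSubgroup.subset_closure ⟨F.mapTriangle.obj T, F.map_distinguished T hT, ?_⟩
    simp [FreeAbelianGroup.map_of_apply])

/-- The induced homomorphism sends the class of `E` to the class of `F E`. -/
lemma K0.map_cls (F : D ⥤ D') [F.CommShift ℤ] [F.IsTriangulated] (E : D) :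
    K0.map F (K0.cls E) = K0.cls (F.obj E) := by
  simp [K0.map, K0.cls, FreeAbelianGroup.map_of_apply]

/-! ### Stability conditions -/

variable (D) in
/-- A pair `(Z, P)`: a central charge `Z : K₀(D) → ℂ` and a family of full subcategories
`P(φ)`, `φ ∈ ℝ`, before any condition is imposed. -/
@[ext]
structure Datum where
  /-- the central charge -/
  Z : K0 D →+ ℂ
  /-- the full subcategories `P(φ)` -/
  P : ℝ → ObjectProperty D

/-- A Harder-Narasimhan filtration
`0 = E₀ ⟶ E₁ ⟶ ⋯ ⟶ Eₙ = E` of `E`, with cones `Aᵢ ∈ P(φᵢ)` and `φ₁ > φ₂ > ⋯ > φₙ`. -/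
structure HNFiltration (P : ℝ → ObjectProperty D) (E : D) where
  n : ℕ
  obj : Fin (n + 1) → D
  factor : Fin n → D
  phase : Fin n → ℝ
  ι (i : Fin n) : obj i.castSucc ⟶ obj i.succ
  π (i : Fin n) : obj i.succ ⟶ factor i
  δ (i : Fin n) : factor i ⟶ (obj i.castSucc)⟦(1 : ℤ)⟧
  triangle (i : Fin n) : Triangle.mk (ι i) (π i) (δ i) ∈ distTriang D
  isZero_zero : IsZero (obj 0)
  lastIso : obj (Fin.last n) ≅ E
  mem (i : Fin n) : P (phase i) (factor i)
  phase_strictAnti : StrictAnti phase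

namespace Datum

/-- The conditions making a pair `(Z, P)` a stability condition. The subcategories `P(φ)` are
full additive subcategories, closed under isomorphism. -/
structure IsStabilityCondition (σ : Datum D) : Prop where
  iso_closed (φ : ℝ) : (σ.P φ).IsClosedUnderIsomorphisms
  contains_zero (φ : ℝ) : (σ.P φ).ContainsZero
  biprod_closed (φ : ℝ) {X Y : D} (b : BinaryBicone X Y) (hb : b.IsBilimit) :
    σ.P φ X → σ.P φ Y → σ.P φ b.pt
  /-- `Z(E) ∈ ℝ_{>0} · exp(iπφ)` for every nonzero `E ∈ P(φ)` -/
  charge (φ : ℝ) (E : D) : σ.P φ E → ¬ IsZero E →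
    ∃ m : ℝ, 0 < m ∧ σ.Z (K0.cls E) = m * Complex.exp (Real.pi * Complex.I * φ)
  hom_eq_zero (φ ψ : ℝ) (E F : D) : ψ < φ → σ.P φ E → σ.P ψ F → ∀ f : E ⟶ F, f = 0
  /-- `P(φ + 1) = P(φ)[1]` -/
  shift (φ : ℝ) (E : D) :
    σ.P (φ + 1) E ↔ ∃ E' : D, σ.P φ E' ∧ Nonempty (E ≅ E'⟦(1 : ℤ)⟧)
  hn (E : D) : Nonempty (HNFiltration σ.P E)

end Datum

/-- The extension closure in `D` of the subcategories `P(φ)`, `φ ∈ I`. -/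
inductive extClosure (P : ℝ → ObjectProperty D) (I : Set ℝ) : ObjectProperty D
  | of_mem {φ : ℝ} {E : D} : φ ∈ I → P φ E → extClosure P I E
  | ext {T : Triangle D} : T ∈ distTriang D →
      extClosure P I T.obj₁ → extClosure P I T.obj₃ → extClosure P I T.obj₂

/-- The strict subobjects of `E`: the subobjects that are kernels. -/
def StrictSubobject {C : Type u₁} [Category.{v₁} C] [HasZeroMorphisms C] (E : C) : Type _ :=
  { S : Subobject E // Nonempty (NormalMono S.arrow) }

instance {C : Type u₁} [Category.{v₁} C] [HasZeroMorphisms C] (E : C) :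
    PartialOrder (StrictSubobject E) :=
  inferInstanceAs (PartialOrder { S : Subobject E // Nonempty (NormalMono S.arrow) })

/-- A (quasi-abelian) category has finite length if the strict subobjects of each of its objects
satisfy the descending and the ascending chain condition. -/
def FiniteLength (C : Type u₁) [Category.{v₁} C] [HasZeroMorphisms C] : Prop :=
  ∀ E : C, WellFoundedLT (StrictSubobject E) ∧ WellFoundedGT (StrictSubobject E)

/-- Local finiteness: every phase `φ` has a neighbourhood `(φ - δ, φ + δ)`, of length less than
one so that the category `P((φ - δ, φ + δ))` is quasi-abelian, for which this category is of
finite length. -/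
def Datum.LocallyFinite (σ : Datum D) : Prop :=
  ∀ φ : ℝ, ∃ δ : ℝ, 0 < δ ∧ δ < 1 / 2 ∧
    FiniteLength (extClosure σ.P (Set.Ioo (φ - δ) (φ + δ))).FullSubcategory

variable (D) in
/-- The set of locally finite stability conditions. -/
def Stab : Type _ := { σ : Datum D // σ.IsStabilityCondition ∧ σ.LocallyFinite }

/-- `E` is `σ`-stable: it is a simple object of some `P(φ)`. -/
def Stab.IsStable (σ : Stab D) (E : D) : Prop :=
  ∃ (φ : ℝ) (h : σ.1.P φ E), Simple (⟨E, h⟩ : (σ.1.P φ).FullSubcategory)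

/-! ### The topology on the space of stability conditions -/

/-- `φ⁺(E) = φ`: the first phase of a Harder-Narasimhan filtration with nonzero factors. -/
def IsPhiPlus (P : ℝ → ObjectProperty D) (E : D) (φ : ℝ) : Prop :=
  ∃ (H : HNFiltration P E) (h : 0 < H.n),
    (∀ i, ¬ IsZero (H.factor i)) ∧ H.phase ⟨0, h⟩ = φ

/-- `φ⁻(E) = φ`: the last phase of a Harder-Narasimhan filtration with nonzero factors. -/
def IsPhiMinus (P : ℝ → ObjectProperty D) (E : D) (φ : ℝ) : Prop :=
  ∃ (H : HNFiltration P E) (h : 0 < H.n),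
    (∀ i, ¬ IsZero (H.factor i)) ∧ H.phase ⟨H.n - 1, Nat.sub_lt h one_pos⟩ = φ

/-- The generalized metric on slicings: the supremum of `|φ⁺_P(E) - φ⁺_Q(E)|` and
`|φ⁻_P(E) - φ⁻_Q(E)|` over all nonzero objects `E`. -/
def slicingDist (P Q : ℝ → ObjectProperty D) : ℝ≥0∞ :=
  (⨆ (E : D) (φ : ℝ) (ψ : ℝ) (_ : IsPhiPlus P E φ) (_ : IsPhiPlus Q E ψ), edist φ ψ) ⊔
  (⨆ (E : D) (φ : ℝ) (ψ : ℝ) (_ : IsPhiMinus P E φ) (_ : IsPhiMinus Q E ψ), edist φ ψ)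

/-- The generalized norm `‖U‖_σ = sup { |U(E)| / |Z(E)| : E semistable in σ }`. -/
def chargeNorm (σ : Datum D) (U : K0 D →+ ℂ) : ℝ≥0∞ :=
  ⨆ (φ : ℝ) (E : D) (_ : σ.P φ E) (_ : ¬ IsZero E), ‖U (K0.cls E)‖ₑ / ‖σ.Z (K0.cls E)‖ₑ

/-- The basic neighbourhood
`B_ε(σ) = { τ = (W, Q) : ‖W - Z‖_σ < sin(πε) and d(P, Q) < ε }` of `σ = (Z, P)`. -/
def Stab.basicNhd (σ : Stab D) (ε : ℝ) : Set (Stab D) :=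
  { τ | chargeNorm σ.1 (τ.1.Z - σ.1.Z) < ENNReal.ofReal (Real.sin (Real.pi * ε)) ∧
    slicingDist σ.1.P τ.1.P < ENNReal.ofReal ε }

/-- Bridgeland's topology, generated by the sets `B_ε(σ)` with `0 < ε < 1/8`. -/
instance : TopologicalSpace (Stab D) :=
  TopologicalSpace.generateFrom
    { B | ∃ (σ : Stab D) (ε : ℝ), 0 < ε ∧ ε < 1 / 8 ∧ B = σ.basicNhd ε }

end Triangulated

/-! ### The complex structure on the space of stability conditions

The complex structure is the one for which the central charge
`Stab(D) → Hom(K₀(D), ℂ)`, `(Z, P) ↦ Z`, is a local isomorphism. -/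

section LocalHomeomorph

variable {X H : Type*} [TopologicalSpace X] [TopologicalSpace H]

/-- The atlas given by the local inverses of a local homeomorphism `f : X → H`; the charts are
the restrictions of `f` to open sets on which it is injective. -/
@[reducible]
def chartedSpaceOfIsLocalHomeomorph (f : X → H) (hf : IsLocalHomeomorph f) :
    ChartedSpace H X where
  atlas := { e | f = e }
  chartAt x := (hf x).choose
  mem_chart_source x := (hf x).choose_spec.1
  chart_mem_atlas x := (hf x).choose_spec.2

end LocalHomeomorph

section ComplexStructure

variable (D : Type u₁) [Category.{v₁} D] [Preadditive D] [HasZeroObject D] [HasShift D ℤ]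
  [∀ n : ℤ, (shiftFunctor D n).Additive] [Pretriangulated D]
  {D' : Type u₂} [Category.{v₂} D'] [Preadditive D'] [HasZeroObject D'] [HasShift D' ℤ]
  [∀ n : ℤ, (shiftFunctor D' n).Additive] [Pretriangulated D']

/-- Linear coordinates on `Hom(K₀(D), ℂ)` (in particular, this space is finite-dimensional) such
that the central charge is a local homeomorphism from `Stab(D)` to `Hom(K₀(D), ℂ) ≅ ℂⁿ`. -/
structure PeriodCoordinates where
  n : ℕ
  coord : (K0 D →+ ℂ) ≃ₗ[ℂ] (Fin n → ℂ)
  isLocalHomeomorph : IsLocalHomeomorph (fun σ : Stab D => coord σ.1.Z)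

variable {D}

/-- The charts of `Stab(D)` given by the central charge. -/
@[reducible]
def PeriodCoordinates.chartedSpace (c : PeriodCoordinates D) :
    ChartedSpace (Fin c.n → ℂ) (Stab D) :=
  chartedSpaceOfIsLocalHomeomorph _ c.isLocalHomeomorph

/-- The charts given by the central charge make `Stab(D)` a complex manifold. -/
lemma PeriodCoordinates.isManifold (c : PeriodCoordinates D) :
    letI := c.chartedSpace
    IsManifold 𝓘(ℂ, Fin c.n → ℂ) ω (Stab D) := by
  let := c.chartedSpace
  refine isManifold_of_contDiffOn _ _ _ fun e e' he he' => ?_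
  refine contDiffOn_id.congr fun y hy => ?_
  obtain ⟨hy, -⟩ := hy
  replace he : (fun σ : Stab D => c.coord σ.1.Z) = e := he
  replace he' : (fun σ : Stab D => c.coord σ.1.Z) = e' := he'
  have h : (e' : Stab D → _) = e := he'.symm.trans he
  have hy' : y ∈ e.target := by
    simp only [mfld_simps] at hy
    exact hy.1
  simp only [mfld_simps]
  rw [h, e.right_inv hy']

/-- A homeomorphism between spaces of stability conditions is biholomorphic with respect to the
complex structures given by the central charges. -/
def IsBiholomorphic (c : PeriodCoordinates D) (c' : PeriodCoordinates D')
    (Φ : Stab D ≃ₜ Stab D') : Prop :=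
  letI := c.chartedSpace
  letI := c'.chartedSpace
  ContMDiff 𝓘(ℂ, Fin c.n → ℂ) 𝓘(ℂ, Fin c'.n → ℂ) ω Φ ∧
    ContMDiff 𝓘(ℂ, Fin c'.n → ℂ) 𝓘(ℂ, Fin c.n → ℂ) ω Φ.symm

/-! ### Inducing stability conditions along an exact functor -/

/-- If `Hom(F a, F b) = 0` then `Hom(a, b) = 0`. -/
def SatisfiesInd (F : D ⥤ D') : Prop :=
  ∀ a b : D, (∀ f : F.obj a ⟶ F.obj b, f = 0) → ∀ g : a ⟶ b, g = 0

/-- The pair `F⁻¹σ' = (Z' ∘ F, { x | F x ∈ P'(φ) })`. -/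
def Datum.pullback (F : D ⥤ D') [F.CommShift ℤ] [F.IsTriangulated] (σ' : Datum D') : Datum D where
  Z := σ'.Z.comp (K0.map F)
  P φ := (σ'.P φ).inverseImage F

/-- `Dom F`: the stability conditions `σ'` on `D'` such that `F⁻¹σ'` lies in `Stab(D)`. -/
def Dom (F : D ⥤ D') [F.CommShift ℤ] [F.IsTriangulated] : Set (Stab D') :=
  { σ' | (σ'.1.pullback F).IsStabilityCondition ∧ (σ'.1.pullback F).LocallyFinite }

/-- The map `F⁻¹ : Dom F → Stab(D)`. -/
def inducedMap (F : D ⥤ D') [F.CommShift ℤ] [F.IsTriangulated] (σ' : Dom F) : Stab D :=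
  ⟨σ'.1.1.pullback F, σ'.2⟩

end ComplexStructure

/-! ### Bounded derived categories of finitely generated modules -/

section Rings

/-- The bounded derived category of finitely generated modules over a noetherian ring. -/
abbrev Db (A : Type u) [Ring A] [IsNoetherianRing A]
    [HasDerivedCategory.{w} (FGModuleCat.{u} A)] : Type _ :=
  DerivedCategory.Bounded (FGModuleCat.{u} A)

/-- An object of an abelian category, placed in degree zero. -/
def inDegreeZero {C : Type u₁} [Category.{v₁} C] [Abelian C] [HasDerivedCategory.{w} C] (M : C) :
    DerivedCategory.Bounded C :=
  ⟨(DerivedCategory.singleFunctor C 0).obj M, ⟨0, inferInstance⟩, ⟨0, inferInstance⟩⟩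

/-- The functor on derived categories induced by an exact functor preserves boundedness. -/
lemma bounded_mapDerivedCategory {C : Type u₁} [Category.{v₁} C] [Abelian C]
    [HasDerivedCategory.{w} C] {C' : Type u₂} [Category.{v₂} C'] [Abelian C']
    [HasDerivedCategory.{w'} C'] (F : C ⥤ C') [F.Additive] [PreservesFiniteLimits F]
    [PreservesFiniteColimits F] (X : DerivedCategory.Bounded C) :
    (DerivedCategory.TStructure.t : Triangulated.TStructure (DerivedCategory C')).bounded
      (F.mapDerivedCategory.obj X.obj) := by
  obtain ⟨⟨a, ⟨K, e, hK⟩⟩, ⟨b, ⟨L, e', hL⟩⟩⟩ := X.property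
  refine ⟨⟨a, ⟨(F.mapHomologicalComplex _).obj K,
      F.mapDerivedCategory.mapIso e ≪≫ F.mapDerivedCategoryFactors.app K, ?_⟩⟩,
    ⟨b, ⟨(F.mapHomologicalComplex _).obj L,
      F.mapDerivedCategory.mapIso e' ≪≫ F.mapDerivedCategoryFactors.app L, ?_⟩⟩⟩
  · rw [CochainComplex.isStrictlyGE_iff] at hK ⊢
    exact fun i hi => F.map_isZero (hK i hi)
  · rw [CochainComplex.isStrictlyLE_iff] at hL ⊢
    exact fun i hi => F.map_isZero (hL i hi)

/-- The exact functor between bounded derived categories induced by an exact functor. -/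
abbrev mapDb {C : Type u₁} [Category.{v₁} C] [Abelian C]
    [HasDerivedCategory.{w} C] {C' : Type u₂} [Category.{v₂} C'] [Abelian C']
    [HasDerivedCategory.{w'} C'] (F : C ⥤ C') [F.Additive] [PreservesFiniteLimits F]
    [PreservesFiniteColimits F] : DerivedCategory.Bounded C ⥤ DerivedCategory.Bounded C' :=
  ObjectProperty.lift _ (DerivedCategory.Bounded.ι ⋙ F.mapDerivedCategory)
    (bounded_mapDerivedCategory F)

variable (R : Type u) [CommRing R] [IsLocalRing R]

lemma isFG_restrictScalars_residue (M : FGModuleCat.{u} (IsLocalRing.ResidueField R)) :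
    ModuleCat.isFG R ((ModuleCat.restrictScalars (IsLocalRing.residue R)).obj M.obj) := by
  have hM : Module.Finite (IsLocalRing.ResidueField R) M.obj := M.property
  let N := (ModuleCat.restrictScalars (IsLocalRing.residue R)).obj M.obj
  let : Module (IsLocalRing.ResidueField R) N :=
    inferInstanceAs (Module (IsLocalRing.ResidueField R) M.obj)
  have : IsScalarTower R (IsLocalRing.ResidueField R) N := ⟨fun r c m => by
    rw [Algebra.smul_def, mul_smul]
    rfl⟩
  have : Module.Finite (IsLocalRing.ResidueField R) N := hM
  exact Module.Finite.trans (R := R) (IsLocalRing.ResidueField R) N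

/-- Restriction of scalars along `R → R/𝔪`, from finitely generated modules over the residue field
to finitely generated `R`-modules: the pushforward of coherent sheaves along
`Spec (R/𝔪) → Spec R`. -/
def residueRestrict : FGModuleCat.{u} (IsLocalRing.ResidueField R) ⥤ FGModuleCat.{u} R :=
  ObjectProperty.lift _
    ((ModuleCat.isFG _).ι ⋙ ModuleCat.restrictScalars.{u} (IsLocalRing.residue R))
    (isFG_restrictScalars_residue R)

instance : (residueRestrict R).Additive where
  map_add := rfl

section

variable [IsNoetherianRing R]

instance : PreservesFiniteLimits (residueRestrict R) :=
  have : PreservesFiniteLimits (residueRestrict R ⋙ forget₂ (FGModuleCat.{u} R) (ModuleCat.{u} R)) :=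
    inferInstanceAs (PreservesFiniteLimits
      (forget₂ (FGModuleCat.{u} (IsLocalRing.ResidueField R)) (ModuleCat.{u} _) ⋙
        ModuleCat.restrictScalars.{u} (IsLocalRing.residue R)))
  preservesFiniteLimits_of_reflects_of_preserves _
    (forget₂ (FGModuleCat.{u} R) (ModuleCat.{u} R))

instance : PreservesFiniteColimits (residueRestrict R) :=
  have : PreservesFiniteColimits
      (residueRestrict R ⋙ forget₂ (FGModuleCat.{u} R) (ModuleCat.{u} R)) :=
    inferInstanceAs (PreservesFiniteColimits
      (forget₂ (FGModuleCat.{u} (IsLocalRing.ResidueField R)) (ModuleCat.{u} _) ⋙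
        ModuleCat.restrictScalars.{u} (IsLocalRing.residue R)))
  preservesFiniteColimits_of_reflects_of_preserves _
    (forget₂ (FGModuleCat.{u} R) (ModuleCat.{u} R))

variable [HasDerivedCategory.{w} (FGModuleCat.{u} R)]
  [HasDerivedCategory.{w'} (FGModuleCat.{u} (IsLocalRing.ResidueField R))]

/-- The residue field, as an object of the bounded derived category of `R`. -/
abbrev residueFieldObj : Db R :=
  inDegreeZero (FGModuleCat.of R (IsLocalRing.ResidueField R))

/-- The functor `j_* : D^b(k) ⥤ D^b(R)` for the inclusion `j : Spec k → Spec R` of the closed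
point. -/
abbrev jPushforward : Db (IsLocalRing.ResidueField R) ⥤ Db R :=
  mapDb (residueRestrict R)

end

end Rings

end Stability

end

open Stability

noncomputable section

namespace Stability

open CategoryTheory.Triangulated

/-! ### Calculus in the Grothendieck group. -/

section K0

variable {D : Type u₁} [Category.{v₁} D] [Preadditive D] [HasZeroObject D] [HasShift D ℤ]
  [∀ n : ℤ, (shiftFunctor D n).Additive] [Pretriangulated D]

/-! The standard heart of either bounded derived category has finite length and a single simple
object K, so any two nonzero objects X, Y of it are linked by a nonzero map X ↠ K ↪ Y. This rigidity
determines all stability conditions. If X is semistable with lowest degree a and highest degree b, a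
nonzero map H^b(X) → H^a(X) induces a nonzero map X[b - a] → X, and comparing phases gives a = b
(`exists_degree_of_semistable`). An object of the heart that is not semistable would receive a
nonzero map from a semistable A and have one to a semistable B of smaller phase, with A in a degree
m ≥ 0 and B in a degree n ≤ 0; a nonzero map A[m - n] → B contradicts the order of the phases
(`semistable_of_degree_zero`). Maps in both directions then give all nonzero objects of the heart
the same phase φ₀, so P(φ₀ + n) is the n-th shift of the heart (`exists_phase`), in which K is
stable for n = 0.

The length identifies K₀ with ℤ·[K] (`eq_smul`), so a stability condition amounts to the complex
number z = log |Z(K)| + iπφ₀. Every z occurs, with truncations as Harder-Narasimhan filtrations.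
Computing the norm and the distance in terms of z turns this bijection into a homeomorphism with ℂ
(`stabHomeomorph`), under which the central charge becomes exp.

The functor j_* preserves and detects degrees and sends k to k, so j_*⁻¹ is the identity in the
coordinate z (`pullback_stdDatum`); it is biholomorphic because it is linear on charges. Over a
field every module is projective, so maps in the bounded derived category are detected on
cohomology, and j_* is faithful (`satisfiesInd_mapDb`). -/

lemma K0.cls_of_distTriang {T : Triangle D} (hT : T ∈ distTriang D) :
    K0.cls T.obj₂ = K0.cls T.obj₁ + K0.cls T.obj₃ := by
  have h : (QuotientAddGroup.mk (FreeAbelianGroup.of T.obj₂ - FreeAbelianGroup.of T.obj₁ -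
      FreeAbelianGroup.of T.obj₃) : K0 D) = 0 :=
    (QuotientAddGroup.eq_zero_iff _).2 (AddSubgroup.subset_closure ⟨T, hT, rfl⟩)
  rw [QuotientAddGroup.mk_sub, QuotientAddGroup.mk_sub, sub_sub, sub_eq_zero] at h
  exact h

open scoped ZeroObject in
lemma K0.cls_zero : K0.cls (0 : D) = 0 := by
  simpa using K0.cls_of_distTriang (contractible_distinguished (0 : D))

open scoped ZeroObject in
lemma K0.cls_eq_of_iso {X Y : D} (e : X ≅ Y) : K0.cls X = K0.cls Y := by
  have h := K0.cls_of_distTriang (T := Triangle.mk e.hom (0 : Y ⟶ 0) 0)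
    ((Triangle.distinguished_iff_of_isZero₃ _ (isZero_zero D)).2
      (inferInstanceAs (IsIso e.hom)))
  change K0.cls Y = K0.cls X + K0.cls (0 : D) at h
  rw [K0.cls_zero, add_zero] at h
  exact h.symm

lemma K0.cls_of_isZero {X : D} (hX : IsZero X) : K0.cls X = 0 := by
  rw [K0.cls_eq_of_iso (hX.iso (isZero_zero D)), K0.cls_zero]

open scoped ZeroObject in
lemma K0.cls_shift_one (X : D) : K0.cls (X⟦(1 : ℤ)⟧) = -K0.cls X := by
  have h := K0.cls_of_distTriang (rot_of_distTriang _ (contractible_distinguished X))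
  change K0.cls (0 : D) = K0.cls X + K0.cls (X⟦(1 : ℤ)⟧) at h
  rw [K0.cls_zero] at h
  exact (neg_eq_of_add_eq_zero_right h.symm).symm

lemma K0.cls_shift (X : D) (n : ℤ) : K0.cls (X⟦n⟧) = n.negOnePow • K0.cls X := by
  have step (n : ℤ) : K0.cls (X⟦n + 1⟧) = -K0.cls (X⟦n⟧) := by
    rw [← K0.cls_shift_one, K0.cls_eq_of_iso ((shiftFunctorAdd D n 1).app X)]
    rfl
  induction n using Int.induction_on with
  | zero => simp [K0.cls_eq_of_iso ((shiftFunctorZero D ℤ).app X)]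
  | succ n ih => rw [step, ih, Int.negOnePow_succ, Units.neg_smul]
  | pred n ih =>
    have h := step (-n - 1)
    rw [sub_add_cancel, ih] at h
    rw [← neg_eq_iff_eq_neg.2 h, Int.negOnePow_sub, Int.negOnePow_one]
    simp

/-- A homomorphism out of the Grothendieck group, given by an additive function on objects. -/
def K0.lift {A : Type*} [AddCommGroup A] (f : D → A)
    (hf : ∀ T : Triangle D, T ∈ distTriang D → f T.obj₂ = f T.obj₁ + f T.obj₃) : K0 D →+ A :=
  QuotientAddGroup.lift _ (FreeAbelianGroup.lift f) (by
    rw [K0Relations, AddSubgroup.closure_le]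
    rintro x ⟨T, hT, rfl⟩
    simp [hf T hT])

lemma K0.lift_cls {A : Type*} [AddCommGroup A] (f : D → A)
    (hf : ∀ T : Triangle D, T ∈ distTriang D → f T.obj₂ = f T.obj₁ + f T.obj₃) (X : D) :
    K0.lift f hf (K0.cls X) = f X := by
  simp [K0.lift, K0.cls]

lemma K0.induction {p : K0 D → Prop} (cls : ∀ X, p (K0.cls X)) (zero : p 0)
    (add : ∀ x y, p x → p y → p (x + y)) (neg : ∀ x, p x → p (-x)) (x : K0 D) : p x := by
  obtain ⟨x, rfl⟩ := QuotientAddGroup.mk_surjective x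
  induction x using FreeAbelianGroup.induction_on with
  | zero => exact zero
  | of X => exact cls X
  | neg X ih => exact neg _ ih
  | add x y hx hy => exact add _ _ hx hy

end K0

section Shift

variable {D : Type u₁} [Category.{v₁} D] [HasShift D ℤ]

lemma isZero_shift_iff [HasZeroMorphisms D] {X : D} (a : ℤ) : IsZero (X⟦a⟧) ↔ IsZero X := by
  refine ⟨fun h => ?_, fun h => Functor.map_isZero _ h⟩
  rw [IsZero.iff_id_eq_zero] at h ⊢
  exact (shiftFunctor D a).map_injective (by simpa using h)

lemma hom_shift_one_eq_zero [Preadditive D] [∀ n : ℤ, (shiftFunctor D n).Additive] {X B : D}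
    (h : ∀ f : X ⟶ B⟦(-1 : ℤ)⟧, f = 0) (g : X⟦(1 : ℤ)⟧ ⟶ B) : g = 0 := by
  let e : B ≅ (B⟦(-1 : ℤ)⟧)⟦(1 : ℤ)⟧ := (shiftFunctorCompIsoId D (-1 : ℤ) 1 (by simp)).symm.app B
  obtain ⟨g', hg'⟩ := (shiftFunctor D (1 : ℤ)).map_surjective (g ≫ e.hom)
  rw [h g', Functor.map_zero] at hg'
  exact (cancel_mono e.hom).1 (hg'.symm.trans zero_comp.symm)

end Shift

/-! ### Phases and maps between semistable objects. -/

section Slicing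

variable {D : Type u₁} [Category.{v₁} D] [Preadditive D] [HasZeroObject D] [HasShift D ℤ]
  [∀ n : ℤ, (shiftFunctor D n).Additive] [Pretriangulated D]

namespace Datum.IsStabilityCondition

variable {σ : Datum D} (hσ : σ.IsStabilityCondition)

include hσ

lemma prop_of_iso {φ : ℝ} {X Y : D} (e : X ≅ Y) (h : σ.P φ X) : σ.P φ Y :=
  have := hσ.iso_closed φ
  (σ.P φ).prop_of_iso e h

lemma prop_of_isZero (φ : ℝ) {X : D} (h : IsZero X) : σ.P φ X := by
  obtain ⟨Y, hY, hP⟩ := (hσ.contains_zero φ).exists_zero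
  exact hσ.prop_of_iso (hY.iso h) hP

lemma shift_mem {φ : ℝ} {E : D} (h : σ.P φ E) (n : ℤ) : σ.P (φ + n) (E⟦n⟧) := by
  induction n using Int.induction_on with
  | zero => simpa using hσ.prop_of_iso ((shiftFunctorZero D ℤ).symm.app E) h
  | succ n ih =>
    have := (hσ.shift _ _).2 ⟨_, ih, ⟨Iso.refl _⟩⟩
    push_cast
    rw [← add_assoc]
    exact hσ.prop_of_iso ((shiftFunctorAdd D (n : ℤ) 1).symm.app E) (by simpa using this)
  | pred n ih =>
    obtain ⟨E', hE', ⟨e⟩⟩ := (hσ.shift (φ + ((-n - 1 : ℤ) : ℝ)) (E⟦(-n : ℤ)⟧)).1 (by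
      convert ih using 1
      push_cast
      ring)
    refine hσ.prop_of_iso ((shiftFunctor D (1 : ℤ)).preimageIso (e.symm ≪≫ ?_)) hE'
    exact (shiftFunctorAdd' D (-n - 1 : ℤ) 1 (-n : ℤ) (by ring)).app E

lemma phase_le {φ ψ : ℝ} {E F : D} (hE : σ.P φ E) (hF : σ.P ψ F) {f : E ⟶ F} (hf : f ≠ 0) :
    φ ≤ ψ :=
  not_lt.1 fun h => hf (hσ.hom_eq_zero _ _ _ _ h hE hF f)

lemma phase_eq {φ ψ : ℝ} {E : D} (hE : σ.P φ E) (hE' : σ.P ψ E) (h : ¬ IsZero E) : φ = ψ := by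
  have h' : 𝟙 E ≠ 0 := fun h0 => h ((IsZero.iff_id_eq_zero E).2 h0)
  exact le_antisymm (hσ.phase_le hE hE' h') (hσ.phase_le hE' hE h')

/-- There are no nonzero maps from a step of a Harder-Narasimhan filtration to a semistable
object whose phase is smaller than all the preceding ones. -/
lemma hom_obj_eq_zero {E : D} (H : HNFiltration σ.P E) (i : ℕ) (hi : i < H.n + 1) {ψ : ℝ}
    (hψ : ∀ j : Fin H.n, j.1 < i → ψ < H.phase j) {B : D} (hB : σ.P ψ B)
    (f : H.obj ⟨i, hi⟩ ⟶ B) : f = 0 := by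
  induction i with
  | zero => exact H.isZero_zero.eq_of_src _ _
  | succ i ih =>
    have hT := H.triangle ⟨i, by lia⟩
    obtain ⟨g, hg⟩ := Triangle.yoneda_exact₂ _ hT f
      (ih (by lia) (fun j hj => hψ j (by lia)) _)
    rw [hg, hσ.hom_eq_zero _ _ _ _ (hψ _ (by simp)) (H.mem _) hB g]
    exact comp_zero

/-- An object is zero, or semistable, or it receives a nonzero map from a semistable object and
has a nonzero map to a semistable object of smaller phase. -/
lemma isZero_or_semistable_or_exists (E : D) :
    IsZero E ∨ (∃ φ, σ.P φ E) ∨ ∃ (φ₁ φ₂ : ℝ) (A B : D) (f : A ⟶ E) (g : E ⟶ B),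
      φ₂ < φ₁ ∧ σ.P φ₁ A ∧ σ.P φ₂ B ∧ f ≠ 0 ∧ g ≠ 0 := by
  obtain ⟨H⟩ := hσ.hn E
  -- Induction along the filtration. The bound of the later phases by `φ₁` is what keeps the map
  -- from `A` nonzero at the next step.
  suffices key : ∀ (i : ℕ) (hi : i < H.n + 1), IsZero (H.obj ⟨i, hi⟩) ∨
      ∃ (φ₁ : ℝ) (A : D) (f : A ⟶ H.obj ⟨i, hi⟩), σ.P φ₁ A ∧ f ≠ 0 ∧
        (∀ j : Fin H.n, i ≤ j.1 → H.phase j < φ₁) ∧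
        (σ.P φ₁ (H.obj ⟨i, hi⟩) ∨ ∃ (φ₂ : ℝ) (B : D) (g : H.obj ⟨i, hi⟩ ⟶ B),
          φ₂ < φ₁ ∧ σ.P φ₂ B ∧ g ≠ 0) by
    obtain h | ⟨φ₁, A, f, hA, hf, -, h | ⟨φ₂, B, g, hφ, hB, hg⟩⟩ := key H.n (by lia)
    · exact Or.inl (h.of_iso H.lastIso.symm)
    · exact Or.inr (Or.inl ⟨φ₁, hσ.prop_of_iso H.lastIso h⟩)
    · refine Or.inr (Or.inr ⟨φ₁, φ₂, A, B, f ≫ H.lastIso.hom, H.lastIso.inv ≫ g, hφ, hA, hB,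
        fun h => hf ?_, fun h => hg ?_⟩)
      · exact (cancel_mono H.lastIso.hom).1 (h.trans zero_comp.symm)
      · exact (cancel_epi H.lastIso.inv).1 (h.trans comp_zero.symm)
  intro i
  induction i with
  | zero => exact fun _ => Or.inl H.isZero_zero
  | succ i ih =>
    intro hi
    let k : Fin H.n := ⟨i, by lia⟩
    have hT := H.triangle k
    have hlt (j : Fin H.n) (hj : i + 1 ≤ j.1) : H.phase j < H.phase k :=
      H.phase_strictAnti (show k.1 < j.1 by simpa [k] using hj)
    change IsZero (H.obj k.succ) ∨ ∃ (φ₁ : ℝ) (A : D) (f : A ⟶ H.obj k.succ), σ.P φ₁ A ∧ f ≠ 0 ∧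
        (∀ j : Fin H.n, i + 1 ≤ j.1 → H.phase j < φ₁) ∧
        (σ.P φ₁ (H.obj k.succ) ∨ ∃ (φ₂ : ℝ) (B : D) (g : H.obj k.succ ⟶ B),
          φ₂ < φ₁ ∧ σ.P φ₂ B ∧ g ≠ 0)
    have ih := ih (by lia)
    change IsZero (H.obj k.castSucc) ∨ ∃ (φ₁ : ℝ) (A : D) (f : A ⟶ H.obj k.castSucc),
        σ.P φ₁ A ∧ f ≠ 0 ∧ (∀ j : Fin H.n, i ≤ j.1 → H.phase j < φ₁) ∧
        (σ.P φ₁ (H.obj k.castSucc) ∨ ∃ (φ₂ : ℝ) (B : D) (g : H.obj k.castSucc ⟶ B),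
          φ₂ < φ₁ ∧ σ.P φ₂ B ∧ g ≠ 0) at ih
    by_cases hA : IsZero (H.factor k)
    · have : IsIso (H.ι k) := (Triangle.isZero₃_iff_isIso₁ _ hT).1 hA
      let e : H.obj k.castSucc ≅ H.obj k.succ := asIso (H.ι k)
      obtain h | ⟨φ₁, A, f, hA, hf, hφ, h⟩ := ih
      · exact Or.inl (h.of_iso e.symm)
      · refine Or.inr ⟨φ₁, A, f ≫ e.hom, hA, fun h => hf ?_, fun j hj => hφ j (by lia), ?_⟩
        · exact (cancel_mono e.hom).1 (h.trans zero_comp.symm)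
        · obtain h | ⟨φ₂, B, g, hφ, hB, hg⟩ := h
          · exact Or.inl (hσ.prop_of_iso e h)
          · exact Or.inr ⟨φ₂, B, e.inv ≫ g, hφ, hB, fun h => hg
              ((cancel_epi e.inv).1 (h.trans comp_zero.symm))⟩
    right
    -- If `π` vanished, the identity of the factor would come from a map out of the shifted previous
    -- step. There is no such nonzero map: all earlier phases exceed the phase of the factor minus
    -- one.
    have hπ : H.π k ≠ 0 := fun h => by
      obtain ⟨g, hg⟩ : ∃ g : (H.obj k.castSucc)⟦(1 : ℤ)⟧ ⟶ H.factor k,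
          𝟙 (H.factor k) = H.δ k ≫ g :=
        Triangle.yoneda_exact₃ _ hT (𝟙 (H.factor k)) ((Category.comp_id (H.π k)).trans h)
      rw [hom_shift_one_eq_zero (fun g' => hσ.hom_obj_eq_zero H i (by lia)
        (ψ := H.phase k + ((-1 : ℤ) : ℝ)) (fun j hj => ?_)
        (hσ.shift_mem (H.mem k) (-1)) g') g, comp_zero] at hg
      · exact hA ((IsZero.iff_id_eq_zero _).2 hg)
      · have : H.phase k < H.phase j := H.phase_strictAnti (show j.1 < k.1 from hj)
        push_cast
        linarith
    obtain h | ⟨φ₁, A, f, hA', hf, hφ, h⟩ := ih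
    · have : IsIso (H.π k) := (Triangle.isZero₁_iff_isIso₂ _ hT).1 h
      refine ⟨H.phase k, H.factor k, inv (H.π k), H.mem k, fun h0 => ?_, hlt,
        Or.inl (hσ.prop_of_iso (asIso (H.π k)).symm (H.mem k))⟩
      exact hA ((IsZero.iff_id_eq_zero _).2 (by rw [← IsIso.inv_hom_id (H.π k), h0, zero_comp]))
    · refine ⟨φ₁, A, f ≫ H.ι k, hA', fun h0 => hf ?_, fun j hj => hφ j (by lia),
        Or.inr ⟨H.phase k, H.factor k, H.π k, hφ k le_rfl, H.mem k, hπ⟩⟩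
      -- If `f` died in the next step, its shift would factor through the new factor, whose phase is
      -- smaller than `φ₁ + 1`.
      obtain ⟨g, hg⟩ : ∃ g : A⟦(1 : ℤ)⟧ ⟶ H.factor k, f⟦(1 : ℤ)⟧' = g ≫ H.δ k :=
        Triangle.coyoneda_exact₁ _ hT (f⟦(1 : ℤ)⟧')
          (((shiftFunctor D (1 : ℤ)).map_comp f (H.ι k)).symm.trans
            ((congrArg _ h0).trans (Functor.map_zero _ _ _)))
      have hlt' : H.phase k < φ₁ + ((1 : ℤ) : ℝ) := by
        have := hφ k le_rfl
        push_cast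
        linarith
      rw [hσ.hom_eq_zero _ _ _ _ hlt' (hσ.shift_mem hA' 1) (H.mem k) g, zero_comp] at hg
      exact (shiftFunctor D (1 : ℤ)).map_injective (by rw [hg, Functor.map_zero])

end Datum.IsStabilityCondition

end Slicing

/-! ### Semistable objects in the presence of a heart with one simple object. -/

section LocalHeart

variable {D : Type u₁} [Category.{v₁} D] [Preadditive D] [HasZeroObject D] [HasShift D ℤ]
  [∀ n : ℤ, (shiftFunctor D n).Additive] [Pretriangulated D]

/-- The objects which are concentrated in degree `n` for a t-structure. -/
def degree (t : TStructure D) (n : ℤ) : ObjectProperty D := fun X => t.IsLE X n ∧ t.IsGE X n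

section degree

variable {t : TStructure D}

lemma degree.of_iso {n : ℤ} {X Y : D} (e : X ≅ Y) (h : degree t n X) : degree t n Y :=
  have := h.1
  have := h.2
  ⟨t.isLE_of_iso e n, t.isGE_of_iso e n⟩

lemma degree.shift {n : ℤ} {X : D} (h : degree t n X) (a n' : ℤ) (hn : a + n' = n) :
    degree t n' (X⟦a⟧) :=
  have := h.1
  have := h.2
  ⟨t.isLE_shift X n a n' hn, t.isGE_shift X n a n' hn⟩

lemma degree_shift_iff {n : ℤ} {X : D} (a n' : ℤ) (hn : a + n' = n) :
    degree t n' (X⟦a⟧) ↔ degree t n X :=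
  and_congr (t.isLE_shift_iff X n a n' hn) (t.isGE_shift_iff X n a n' hn)

lemma eq_of_degree_of_degree {m n : ℤ} {X : D} (h : degree t m X) (h' : degree t n X)
    (hX : ¬ IsZero X) : m = n := by
  have := h.1
  have := h.2
  have := h'.1
  have := h'.2
  rcases lt_trichotomy m n with hmn | hmn | hmn
  · exact (hX (t.isZero X m n hmn)).elim
  · exact hmn
  · exact (hX (t.isZero X n m hmn)).elim

end degree

/-- `K` is the unique simple object, up to isomorphism, of the heart of the bounded t-structure
`t`, this heart has finite length, and `rk` is the length. -/
structure IsLocalHeart (t : TStructure D) (K : D) (rk : K0 D →+ ℤ) : Prop where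
  exists_isGE (X : D) : ∃ a, t.IsGE X a
  exists_isLE (X : D) : ∃ b, t.IsLE X b
  degree_zero : degree t 0 K
  rk_eq_one : rk (K0.cls K) = 1
  rk_pos (X : D) : degree t 0 X → ¬ IsZero X → 0 < rk (K0.cls X)
  cls_eq (X : D) : degree t 0 X → K0.cls X = rk (K0.cls X) • K0.cls K
  exists_hom_ne_zero (X Y : D) : degree t 0 X → degree t 0 Y → ¬ IsZero X → ¬ IsZero Y →
    ∃ f : X ⟶ Y, f ≠ 0
  finiteLength (n : ℤ) : FiniteLength (degree t n).FullSubcategory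
  simple : Simple (⟨K, degree_zero⟩ : (degree t 0).FullSubcategory)

namespace IsLocalHeart

variable {t : TStructure D} {K : D} {rk : K0 D →+ ℤ} (h : IsLocalHeart t K rk)

include h

lemma not_isZero : ¬ IsZero K := fun hK => by
  simpa [K0.cls_of_isZero hK] using h.rk_eq_one

lemma exists_hom_ne_zero_of_degree {n : ℤ} {X Y : D} (hX : degree t n X) (hY : degree t n Y)
    (hX' : ¬ IsZero X) (hY' : ¬ IsZero Y) : ∃ f : X ⟶ Y, f ≠ 0 := by
  obtain ⟨f, hf⟩ := h.exists_hom_ne_zero (X⟦n⟧) (Y⟦n⟧) (hX.shift n 0 (by simp))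
    (hY.shift n 0 (by simp)) (by rwa [isZero_shift_iff]) (by rwa [isZero_shift_iff])
  obtain ⟨g, rfl⟩ := (shiftFunctor D n).map_surjective f
  exact ⟨g, fun hg => hf (by rw [hg, Functor.map_zero])⟩

/-- The range of the degrees of a nonzero object. -/
lemma exists_amplitude {X : D} (hX : ¬ IsZero X) :
    ∃ a b : ℤ, a ≤ b ∧ t.IsGE X a ∧ t.IsLE X b ∧ ¬ t.IsGE X (a + 1) ∧ ¬ t.IsLE X (b - 1) := by
  obtain ⟨a₀, ha₀⟩ := h.exists_isGE X
  obtain ⟨b₀, hb₀⟩ := h.exists_isLE X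
  have le {a b : ℤ} (ha : t.IsGE X a) (hb : t.IsLE X b) : a ≤ b :=
    not_lt.1 fun hab => hX (t.isZero X b a hab)
  obtain ⟨a, ha, ha'⟩ := Int.exists_greatest_of_bdd (P := fun a => t.IsGE X a)
    ⟨b₀, fun a ha => le ha hb₀⟩ ⟨a₀, ha₀⟩
  obtain ⟨b, hb, hb'⟩ := Int.exists_least_of_bdd (P := fun b => t.IsLE X b)
    ⟨a₀, fun b hb => le ha₀ hb⟩ ⟨b₀, hb₀⟩
  exact ⟨a, b, le ha hb, ha, hb, fun h => by have := ha' _ h; lia,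
    fun h => by have := hb' _ h; lia⟩

variable [IsTriangulated D]

/-- Project the shift onto its top cohomology, now in degree `a`, map this to the bottom cohomology
of `X`, and include. The composite is nonzero since neither truncation map kills anything: maps to
an object in degrees ≥ `a` factor uniquely through `truncGE a`, and dually for `truncLT (a + 1)`. -/
lemma exists_shift_hom_ne_zero {X : D} {a b : ℤ} (ha : t.IsGE X a) (hb : t.IsLE X b)
    (ha' : ¬ t.IsGE X (a + 1)) (hb' : ¬ t.IsLE X (b - 1)) :
    ∃ f : X⟦b - a⟧ ⟶ X, f ≠ 0 := by
  have hY : t.IsLE (X⟦b - a⟧) a := t.isLE_shift X b _ _ (by lia)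
  have hW : t.IsLE ((t.truncGE a).obj (X⟦b - a⟧)) a := inferInstance
  have hV : t.IsGE ((t.truncLT (a + 1)).obj X) a := inferInstance
  have hV' : t.IsLE ((t.truncLT (a + 1)).obj X) a := inferInstance
  obtain ⟨g, hg⟩ := h.exists_hom_ne_zero_of_degree (n := a)
    (X := (t.truncGE a).obj (X⟦b - a⟧)) (Y := (t.truncLT (a + 1)).obj X)
    ⟨hW, inferInstance⟩ ⟨hV', hV⟩
    -- Both extreme cohomology objects are nonzero because the bounds `a` and `b` are sharp.
    (fun h0 => hb' ((t.isLE_shift_iff X (b - 1) (b - a) (a - 1) (by lia)).1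
      ((t.isLE_iff_isZero_truncGE_obj (a - 1) a (by lia) _).2 h0)))
    (fun h0 => ha' ((t.isGE_iff_isZero_truncLT_obj (a + 1) X).2 h0))
  refine ⟨(t.truncGEπ a).app _ ≫ g ≫ (t.truncLTι (a + 1)).app X, fun h0 => hg ?_⟩
  have h1 : g ≫ (t.truncLTι (a + 1)).app X = 0 := by
    have : t.IsGE ((𝟭 D).obj X) a := ha
    exact t.from_truncGE_obj_ext (h0.trans comp_zero.symm)
  have : t.IsLE ((t.truncGE a).obj (X⟦b - a⟧)) (a + 1 - 1) := by simpa using hW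
  exact t.to_truncLT_obj_ext (h1.trans zero_comp.symm)

/-- A nonzero map from `X⟦b - a⟧`, of phase `φ + (b - a)`, to `X`, of phase `φ`, forces `b ≤ a`. -/
lemma exists_degree_of_semistable {σ : Datum D} (hσ : σ.IsStabilityCondition) {φ : ℝ} {X : D}
    (hX : σ.P φ X) (hX' : ¬ IsZero X) : ∃ n, degree t n X := by
  obtain ⟨a, b, hab, ha, hb, ha', hb'⟩ := h.exists_amplitude hX'
  obtain ⟨f, hf⟩ := h.exists_shift_hom_ne_zero ha hb ha' hb'
  have := hσ.phase_le (hσ.shift_mem hX (b - a)) hX hf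
  have : b ≤ a := by
    have : (b : ℝ) ≤ a := by push_cast at this; linarith
    exact_mod_cast this
  obtain rfl : a = b := by lia
  exact ⟨a, hb, ha⟩

lemma semistable_of_degree_zero {σ : Datum D} (hσ : σ.IsStabilityCondition) {X : D}
    (hX : degree t 0 X) : ∃ φ, σ.P φ X := by
  obtain h0 | h0 | ⟨φ₁, φ₂, A, B, f, g, hφ, hA, hB, hf, hg⟩ :=
    hσ.isZero_or_semistable_or_exists X
  · exact ⟨0, hσ.prop_of_isZero 0 h0⟩
  · exact h0
  · exfalso
    have hA0 : ¬ IsZero A := fun h0 => hf (h0.eq_of_src _ _)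
    have hB0 : ¬ IsZero B := fun h0 => hg (h0.eq_of_tgt _ _)
    obtain ⟨m, hm⟩ := h.exists_degree_of_semistable hσ hA hA0
    obtain ⟨n, hn⟩ := h.exists_degree_of_semistable hσ hB hB0
    have hm0 : 0 ≤ m := not_lt.1 fun h0 => hf (t.zero_of_isLE_of_isGE f m 0 h0 hm.1 hX.2)
    have hn0 : n ≤ 0 := not_lt.1 fun h0 => hg (t.zero_of_isLE_of_isGE g 0 n h0 hX.1 hn.2)
    -- This map gives `φ₁ + (m - n) ≤ φ₂`, impossible as `m ≥ n` and `φ₂ < φ₁`.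
    obtain ⟨q, hq⟩ := h.exists_hom_ne_zero_of_degree (hm.shift (m - n) n (by lia)) hn
      (by rwa [isZero_shift_iff]) hB0
    have := hσ.phase_le (hσ.shift_mem hA (m - n)) hB hq
    have hmn : (0 : ℝ) ≤ ((m - n : ℤ) : ℝ) := by exact_mod_cast (by lia : 0 ≤ m - n)
    linarith

/-- The semistable objects of any stability condition are the shifts of the objects of the
heart. -/
theorem exists_phase {σ : Datum D} (hσ : σ.IsStabilityCondition) :
    ∃ φ₀ : ℝ, ∀ (ψ : ℝ) (X : D),
      σ.P ψ X ↔ IsZero X ∨ ∃ n : ℤ, ψ = φ₀ + n ∧ degree t (-n) X := by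
  obtain ⟨φ₀, hφ₀⟩ := h.semistable_of_degree_zero hσ h.degree_zero
  have key {X : D} (hX : degree t 0 X) : σ.P φ₀ X := by
    by_cases hX0 : IsZero X
    · exact hσ.prop_of_isZero _ hX0
    obtain ⟨φ, hφ⟩ := h.semistable_of_degree_zero hσ hX
    obtain ⟨f, hf⟩ := h.exists_hom_ne_zero_of_degree hX h.degree_zero hX0 h.not_isZero
    obtain ⟨g, hg⟩ := h.exists_hom_ne_zero_of_degree h.degree_zero hX h.not_isZero hX0
    rwa [le_antisymm (hσ.phase_le hφ₀ hφ hg) (hσ.phase_le hφ hφ₀ hf)]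
  refine ⟨φ₀, fun ψ X => ⟨fun hX => ?_, ?_⟩⟩
  · refine or_iff_not_imp_left.2 fun hX0 => ?_
    obtain ⟨n, hn⟩ := h.exists_degree_of_semistable hσ hX hX0
    refine ⟨-n, ?_, by simpa using hn⟩
    have := hσ.phase_eq (hσ.shift_mem hX n) (key (hn.shift n 0 (by simp)))
      (by rwa [isZero_shift_iff])
    push_cast
    linarith
  · rintro (hX | ⟨n, rfl, hX⟩)
    · exact hσ.prop_of_isZero _ hX
    · exact hσ.prop_of_iso ((shiftEquiv D n).counitIso.app X)
        (hσ.shift_mem (key (hX.shift (-n) 0 (by simp))) n)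

end IsLocalHeart

end LocalHeart

/-! ### Construction of Harder-Narasimhan filtrations. -/

section HarderNarasimhan

variable {D : Type u₁} [Category.{v₁} D] [Preadditive D] [HasZeroObject D] [HasShift D ℤ]
  [∀ n : ℤ, (shiftFunctor D n).Additive] [Pretriangulated D]

/-- Constructor for Harder-Narasimhan filtrations, from families indexed by natural numbers. -/
def HNFiltration.ofNat {P : ℝ → ObjectProperty D} {E : D} (n : ℕ) (obj factor : ℕ → D)
    (phase : ℕ → ℝ)
    (hT : ∀ i < n, ∃ (f : obj i ⟶ obj (i + 1)) (g : obj (i + 1) ⟶ factor i)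
      (h : factor i ⟶ (obj i)⟦(1 : ℤ)⟧), Triangle.mk f g h ∈ distTriang D)
    (h0 : IsZero (obj 0)) (e : obj n ≅ E) (hP : ∀ i < n, P (phase i) (factor i))
    (hphase : StrictAnti phase) : HNFiltration P E where
  n := n
  obj i := obj i
  factor i := factor i
  phase i := phase i
  ι i := (hT i i.2).choose
  π i := (hT i i.2).choose_spec.choose
  δ i := (hT i i.2).choose_spec.choose_spec.choose
  triangle i := (hT i i.2).choose_spec.choose_spec.choose_spec
  isZero_zero := h0
  lastIso := e
  mem i := hP i i.2
  phase_strictAnti _ _ hij := hphase hij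

open scoped ZeroObject in
/-- The Harder-Narasimhan filtration of a semistable object. -/
def HNFiltration.ofMem {P : ℝ → ObjectProperty D} {E : D} {φ : ℝ} (hE : P φ E) :
    HNFiltration P E :=
  -- Only index 0 carries a factor; `φ - i` merely extends its phase to a strictly decreasing
  -- sequence.
  HNFiltration.ofNat 1 (fun i => if i = 0 then 0 else E) (fun _ => E) (fun i => φ - i)
    (fun i hi => by
      obtain rfl : i = 0 := by lia
      exact ⟨0, 𝟙 E, 0, contractible_distinguished₁ E⟩)
    (Limits.isZero_zero D) (Iso.refl E)
    (fun i hi => by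
      obtain rfl : i = 0 := by lia
      simpa using hE)
    (fun i j hij => by simpa using hij)

lemma isPhiPlus_of_mem {P : ℝ → ObjectProperty D} {E : D} {φ : ℝ} (hE : P φ E)
    (h : ¬ IsZero E) : IsPhiPlus P E φ :=
  ⟨HNFiltration.ofMem hE, one_pos, fun _ => h, by simp [HNFiltration.ofMem, HNFiltration.ofNat]⟩

end HarderNarasimhan

lemma finiteLength_of_isZero {C : Type u₁} [Category.{v₁} C] [HasZeroMorphisms C]
    (h : ∀ E : C, IsZero E) : FiniteLength C := by
  intro E
  have hle (S T : Subobject E) : S ≤ T :=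
    Subobject.le_of_comm 0 ((h E).eq_of_tgt _ _)
  have : Subsingleton (StrictSubobject E) :=
    ⟨fun S T => Subtype.ext (le_antisymm (hle _ _) (hle _ _))⟩
  exact ⟨inferInstance, inferInstance⟩

/-! ### Classification: stability conditions are parametrised by ℂ. -/

section StandardDatum

variable {D : Type u₁} [Category.{v₁} D] [Preadditive D] [HasZeroObject D] [HasShift D ℤ]
  [∀ n : ℤ, (shiftFunctor D n).Additive] [Pretriangulated D]

section

variable {t : TStructure D}

lemma degree_of_isZero {X : D} (hX : IsZero X) (n : ℤ) : degree t n X :=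
  ⟨t.isLE_of_isZero hX n, t.isGE_of_isZero hX n⟩

lemma degree_of_distTriang {T : Triangle D} (hT : T ∈ distTriang D) {n : ℤ}
    (h₁ : degree t n T.obj₁) (h₃ : degree t n T.obj₃) : degree t n T.obj₂ :=
  ⟨t.isLE₂ T hT n h₁.1 h₃.1, t.isGE₂ T hT n h₁.2 h₃.2⟩

end

/-- The central charge `exp z` times the rank, together with the slicing whose semistable objects
of phase `Im z / π + n` are the objects in degree `-n`. -/
def stdDatum (t : TStructure D) (rk : K0 D →+ ℤ) (z : ℂ) : Datum D where
  Z := (AddMonoidHom.mulRight (Complex.exp z)).comp ((Int.castAddHom ℂ).comp rk)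
  P ψ X := IsZero X ∨ ∃ n : ℤ, ψ = z.im / Real.pi + n ∧ degree t (-n) X

variable {t : TStructure D} {K : D} {rk : K0 D →+ ℤ}

@[simp]
lemma stdDatum_Z (z : ℂ) (x : K0 D) : (stdDatum t rk z).Z x = rk x * Complex.exp z := rfl

lemma stdDatum_P_iff (z : ℂ) (n : ℤ) (X : D) :
    (stdDatum t rk z).P (z.im / Real.pi + n) X ↔ degree t (-n) X := by
  refine ⟨?_, fun h => Or.inr ⟨n, rfl, h⟩⟩
  rintro (h | ⟨m, hm, h⟩)
  · exact degree_of_isZero h _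
  · obtain rfl : n = m := by exact_mod_cast add_left_cancel hm
    exact h

lemma stdDatum_P_iff_isZero (z : ℂ) {ψ : ℝ} (hψ : ∀ n : ℤ, ψ ≠ z.im / Real.pi + n) (X : D) :
    (stdDatum t rk z).P ψ X ↔ IsZero X :=
  or_iff_left fun ⟨n, hn, _⟩ => hψ n hn

lemma stdDatum_P_of_distTriang (z : ℂ) (ψ : ℝ) {T : Triangle D} (hT : T ∈ distTriang D)
    (h₁ : (stdDatum t rk z).P ψ T.obj₁) (h₃ : (stdDatum t rk z).P ψ T.obj₃) :
    (stdDatum t rk z).P ψ T.obj₂ := by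
  by_cases hψ : ∃ n : ℤ, ψ = z.im / Real.pi + n
  · obtain ⟨n, rfl⟩ := hψ
    rw [stdDatum_P_iff] at *
    exact degree_of_distTriang hT h₁ h₃
  · push Not at hψ
    rw [stdDatum_P_iff_isZero z hψ] at *
    exact Triangle.isZero₂_of_isZero₁₃ _ hT h₁ h₃

lemma stdDatum_P_of_iso (z : ℂ) (ψ : ℝ) {X Y : D} (e : X ≅ Y)
    (h : (stdDatum t rk z).P ψ X) : (stdDatum t rk z).P ψ Y := by
  obtain h | ⟨n, hn, h⟩ := h
  · exact Or.inl (h.of_iso e.symm)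
  · exact Or.inr ⟨n, hn, h.of_iso e⟩

lemma stdDatum_P_shift_iff (z : ℂ) (ψ : ℝ) (X : D) :
    (stdDatum t rk z).P (ψ + 1) (X⟦(1 : ℤ)⟧) ↔ (stdDatum t rk z).P ψ X := by
  refine or_congr (isZero_shift_iff 1) ⟨?_, ?_⟩
  · rintro ⟨n, hn, h⟩
    refine ⟨n - 1, ?_, (degree_shift_iff 1 (-n) (by lia)).1 h⟩
    push_cast
    linarith
  · rintro ⟨n, hn, h⟩
    refine ⟨n + 1, ?_, h.shift 1 _ (by lia)⟩
    push_cast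
    linarith

namespace IsLocalHeart

variable (h : IsLocalHeart t K rk)

include h

lemma rk_degree {X : D} {n : ℤ} (hX : degree t n X) (hX' : ¬ IsZero X) :
    ∃ r : ℤ, 0 < r ∧ rk (K0.cls X) = n.negOnePow * r := by
  refine ⟨rk (K0.cls (X⟦n⟧)), h.rk_pos _ (hX.shift n 0 (by simp)) (by rwa [isZero_shift_iff]), ?_⟩
  rw [K0.cls_shift, Units.smul_def, map_zsmul, smul_eq_mul, ← mul_assoc, ← Units.val_mul,
    ← Int.negOnePow_add, Int.negOnePow_even _ ⟨n, rfl⟩]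
  simp

variable [IsTriangulated D]

/-- Truncation splits off one cohomological degree at a time, and in a single degree the claim is a
shift of `cls_eq`. -/
lemma cls_eq_smul (X : D) : K0.cls X = rk (K0.cls X) • K0.cls K := by
  have hdeg {n : ℤ} {X : D} (hX : degree t n X) : K0.cls X = rk (K0.cls X) • K0.cls K := by
    have := h.cls_eq _ (hX.shift n 0 (by simp))
    rw [K0.cls_shift, Units.smul_def, map_zsmul, smul_assoc] at this
    simpa [← Units.smul_def] using this
  obtain ⟨a, ha⟩ := h.exists_isGE X
  obtain ⟨b, hb⟩ := h.exists_isLE X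
  -- `N` counts the degrees `a, …, a + N - 1`; for `N = 0` the object is zero.
  obtain ⟨N, hN⟩ : ∃ N : ℕ, b ≤ a + N - 1 := ⟨(b - a + 1).toNat, by lia⟩
  replace hb : t.IsLE X (a + N - 1) := t.isLE_of_le X b _ hN
  clear hN
  induction N generalizing X with
  | zero =>
    have h0 : IsZero X := t.isZero X (a + (0 : ℕ) - 1) a (by simp)
    simp [K0.cls_of_isZero h0]
  | succ N ih =>
    have hT := t.triangleLTGE_distinguished (a + N) X
    have hcls : K0.cls X = K0.cls ((t.truncLT (a + N)).obj X) +
      K0.cls ((t.truncGE (a + N)).obj X) := K0.cls_of_distTriang hT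
    have h1 := ih ((t.truncLT (a + N)).obj X) inferInstance inferInstance
    have hb' : t.IsLE X (a + N) := by
      convert hb using 1
      push_cast
      ring
    have h2 := hdeg (n := a + N) (X := (t.truncGE (a + N)).obj X) ⟨inferInstance, inferInstance⟩
    rw [hcls, map_add, add_smul, ← h1, ← h2]

/-- As `K` has rank one, K₀ is infinite cyclic on its class, and a central charge is determined by
its value there. -/
lemma eq_smul (x : K0 D) : x = rk x • K0.cls K := by
  induction x using K0.induction with
  | cls X => exact h.cls_eq_smul X
  | zero => simp
  | add x y hx hy => rw [map_add, add_smul, ← hx, ← hy]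
  | neg x hx => rw [map_neg, neg_smul, ← hx]

lemma exists_hnFiltration (z : ℂ) (X : D) :
    Nonempty (HNFiltration (stdDatum t rk z).P X) := by
  obtain ⟨a, ha⟩ := h.exists_isGE X
  obtain ⟨b, hb⟩ := h.exists_isLE X
  have hb' : t.IsLE X (a + (b - a + 1).toNat - 1) := t.isLE_of_le X b _ (by lia)
  have := (t.isLE_iff_isIso_truncLTι_app _ (a + (b - a + 1).toNat) (by lia) X).1 hb'
  -- The filtration by truncations. Degree `a + i` has phase `Im z / π - (a + i)`, so phases
  -- decrease as degrees grow; zero factors are allowed.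
  refine ⟨HNFiltration.ofNat (b - a + 1).toNat (fun i => (t.truncLT (a + i)).obj X)
    (fun i => (t.truncGELT (a + i) (a + (i + 1 : ℕ))).obj X) (fun i => z.im / Real.pi + (-(a + i) : ℤ))
    (fun i _ => ?_) ?_ (asIso ((t.truncLTι (a + (b - a + 1).toNat)).app X)) (fun i _ => ?_) ?_⟩
  · exact ⟨_, _, _, t.triangleLTLTGELT_distinguished (a + i) (a + (i + 1 : ℕ)) (by lia) X⟩
  · simpa using t.isZero_truncLT_obj_of_isGE a X
  · rw [stdDatum_P_iff, neg_neg]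
    have : t.IsLE ((t.truncLT (a + (i + 1 : ℕ))).obj X) (a + i) := t.isLE_truncLT_obj X _ _ (by lia)
    exact ⟨inferInstanceAs (t.IsLE ((t.truncGE (a + i)).obj ((t.truncLT _).obj X)) _),
      inferInstance⟩
  · intro i j hij
    have : (i : ℝ) < j := by exact_mod_cast hij
    push_cast
    linarith

lemma isStabilityCondition_stdDatum (z : ℂ) : (stdDatum t rk z).IsStabilityCondition where
  iso_closed φ := ⟨fun e hX => stdDatum_P_of_iso z φ e hX⟩
  contains_zero φ := ⟨_, isZero_zero D, Or.inl (isZero_zero D)⟩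
  biprod_closed φ X Y b hb hX hY :=
    stdDatum_P_of_iso z φ (biprod.uniqueUpToIso X Y hb).symm
      (stdDatum_P_of_distTriang z φ (binaryBiproductTriangle_distinguished X Y) hX hY)
  charge φ E hE hE' := by
    obtain ⟨n, rfl, hn⟩ := hE.resolve_left hE'
    obtain ⟨r, hr, hr'⟩ := h.rk_degree hn hE'
    refine ⟨r * Real.exp z.re, mul_pos (by exact_mod_cast hr) (Real.exp_pos _), ?_⟩
    have h1 : Complex.exp z = Real.exp z.re * Complex.exp (Real.pi * Complex.I *
        (z.im / Real.pi : ℝ)) := by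
      rw [Complex.ofReal_exp, ← Complex.exp_add]
      congr 1
      have : (Real.pi : ℂ) ≠ 0 := by exact_mod_cast Real.pi_ne_zero
      push_cast
      rw [mul_div_assoc', mul_assoc, mul_div_cancel_left₀ _ this, mul_comm Complex.I,
        Complex.re_add_im]
    -- The sign of the rank in degree `-n` is exactly the rotation caused by the phase shift `n`.
    have h2 : Complex.exp (Real.pi * Complex.I * (n : ℝ)) = ((n.negOnePow : ℤ) : ℂ) := by
      rw [mul_comm, Complex.ofReal_intCast, Complex.exp_int_mul, Complex.exp_pi_mul_I,
        Int.cast_negOnePow]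
    rw [stdDatum_Z, hr', Int.negOnePow_neg, h1, Complex.ofReal_add, mul_add, Complex.exp_add, h2]
    push_cast
    ring
  hom_eq_zero φ ψ E F hlt hE hF f := by
    obtain hE | ⟨m, rfl, hE⟩ := hE
    · exact hE.eq_of_src _ _
    obtain hF | ⟨n, rfl, hF⟩ := hF
    · exact hF.eq_of_tgt _ _
    have : n < m := by exact_mod_cast (add_lt_add_iff_left _).1 hlt
    exact t.zero_of_isLE_of_isGE f (-m) (-n) (by lia) hE.1 hF.2
  shift φ E := by
    refine ⟨fun hE => ?_, ?_⟩
    · let e : E ≅ (E⟦(-1 : ℤ)⟧)⟦(1 : ℤ)⟧ :=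
        (shiftFunctorCompIsoId D (-1 : ℤ) 1 (by simp)).symm.app E
      exact ⟨_, (stdDatum_P_shift_iff z φ _).1 (stdDatum_P_of_iso z _ e hE), ⟨e⟩⟩
    · rintro ⟨E', hE', ⟨e⟩⟩
      exact stdDatum_P_of_iso z _ e.symm ((stdDatum_P_shift_iff z φ _).2 hE')
  hn E := h.exists_hnFiltration z E

omit [IsTriangulated D] in
-- The phases of nonzero semistable objects form a coset of ℤ, and an open interval of length 1/2
-- contains at most one of them. Its extension closure is therefore a shift of the heart, or zero.
lemma locallyFinite_stdDatum (z : ℂ) : (stdDatum t rk z).LocallyFinite := by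
  refine fun φ => ⟨1 / 4, by norm_num, by norm_num, ?_⟩
  by_cases hn : ∃ n : ℤ, z.im / Real.pi + n ∈ Set.Ioo (φ - 1 / 4) (φ + 1 / 4)
  · obtain ⟨n, hn⟩ := hn
    have heq : extClosure (stdDatum t rk z).P (Set.Ioo (φ - 1 / 4) (φ + 1 / 4)) =
        degree t (-n) := by
      ext E
      refine ⟨fun hE => ?_, fun hE => .of_mem hn ((stdDatum_P_iff z n E).2 hE)⟩
      induction hE with
      | ext hT _ _ h₁ h₃ => exact degree_of_distTriang hT h₁ h₃
      | of_mem hψ hE =>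
        obtain hE | ⟨m, rfl, hE⟩ := hE
        · exact degree_of_isZero hE _
        · have h1 : (m : ℝ) - n < 1 := by linarith [hn.1, hψ.2]
          have h2 : (n : ℝ) - m < 1 := by linarith [hn.2, hψ.1]
          obtain rfl : m = n := by
            have h1 : m - n < 1 := by exact_mod_cast h1
            have h2 : n - m < 1 := by exact_mod_cast h2
            lia
          exact hE
    rw [heq]
    exact h.finiteLength (-n)
  · push Not at hn
    refine finiteLength_of_isZero fun E => ?_
    have key {X : D} (hX : extClosure (stdDatum t rk z).P
        (Set.Ioo (φ - 1 / 4) (φ + 1 / 4)) X) : IsZero X := by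
      induction hX with
      | ext hT _ _ h₁ h₃ => exact Triangle.isZero₂_of_isZero₁₃ _ hT h₁ h₃
      | of_mem hψ hE =>
        refine hE.resolve_right ?_
        rintro ⟨m, rfl, -⟩
        exact hn m hψ
    have := key E.property
    rw [IsZero.iff_id_eq_zero] at this ⊢
    exact ObjectProperty.hom_ext _ this

/-- The stability conditions on a triangulated category with a local heart. -/
def stab (z : ℂ) : Stab D :=
  ⟨stdDatum t rk z, h.isStabilityCondition_stdDatum z, h.locallyFinite_stdDatum z⟩

@[simp]
lemma stab_val (z : ℂ) : (h.stab z).1 = stdDatum t rk z := rfl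

omit [IsTriangulated D] in
-- The charge of `K` alone gives `z` modulo 2πi; the phase of `K` removes the ambiguity.
lemma stdDatum_injective : Function.Injective (stdDatum t rk) := fun z w hzw => by
  have hK : (stdDatum t rk w).P (z.im / Real.pi + (0 : ℤ)) K := by
    rw [← hzw, stdDatum_P_iff]
    exact h.degree_zero
  obtain ⟨n, hn, hK'⟩ := hK.resolve_left h.not_isZero
  obtain rfl : n = 0 := by simpa using eq_of_degree_of_degree hK' h.degree_zero h.not_isZero
  have him : z.im = w.im := by
    have := add_right_cancel hn
    field_simp at this
    exact this
  have hZ : Complex.exp z = Complex.exp w := by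
    simpa [h.rk_eq_one] using DFunLike.congr_fun (congrArg Datum.Z hzw) (K0.cls K)
  refine Complex.ext ?_ him
  have := congrArg norm hZ
  rwa [Complex.norm_exp, Complex.norm_exp, Real.exp_eq_exp] at this

/-- The parameter is log |Z(K)| + iπφ₀, where φ₀ is the phase of `K`. -/
lemma exists_eq_stdDatum {σ : Datum D} (hσ : σ.IsStabilityCondition) :
    ∃ z, σ = stdDatum t rk z := by
  obtain ⟨φ₀, hφ₀⟩ := h.exists_phase hσ
  obtain ⟨m, hm, hm'⟩ := hσ.charge φ₀ K
    ((hφ₀ _ _).2 (Or.inr ⟨0, by simp, by simpa using h.degree_zero⟩)) h.not_isZero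
  have him : ((Real.log m : ℂ) + (Real.pi * φ₀ : ℝ) * Complex.I).im = Real.pi * φ₀ := by simp
  refine ⟨(Real.log m : ℂ) + (Real.pi * φ₀ : ℝ) * Complex.I, Datum.ext ?_ ?_⟩
  · refine DFunLike.ext _ _ fun x => ?_
    rw [stdDatum_Z, Complex.exp_add, ← Complex.ofReal_exp, Real.exp_log hm]
    conv_lhs => rw [h.eq_smul x, map_zsmul, hm', zsmul_eq_mul]
    congr 3
    push_cast
    ring
  · ext ψ X
    rw [hφ₀]
    change _ ↔ _ ∨ ∃ n : ℤ, ψ = _ / Real.pi + n ∧ _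
    rw [him, mul_div_cancel_left₀ _ Real.pi_ne_zero]

/-- The bijection between `ℂ` and the space of stability conditions. -/
def stabEquiv : ℂ ≃ Stab D :=
  Equiv.ofBijective h.stab ⟨fun _ _ hzw => h.stdDatum_injective (congrArg Subtype.val hzw),
    fun σ => by
      obtain ⟨z, hz⟩ := h.exists_eq_stdDatum σ.2.1
      exact ⟨z, Subtype.ext hz.symm⟩⟩

lemma stab_isStable (z : ℂ) : (h.stab z).IsStable K := by
  have heq : (stdDatum t rk z).P (z.im / Real.pi + (0 : ℤ)) = degree t 0 := by
    ext X
    simpa using stdDatum_P_iff (t := t) (rk := rk) z 0 X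
  refine ⟨z.im / Real.pi + (0 : ℤ), (stdDatum_P_iff z 0 K).2 h.degree_zero, ?_⟩
  -- Simplicity refers to the full subcategory as a type, so the property is generalised before the
  -- equality is substituted.
  have : ∀ (P : ObjectProperty D) (_ : P = degree t 0) (hK : P K),
      Simple (⟨K, hK⟩ : P.FullSubcategory) := by
    rintro _ rfl _
    exact h.simple
  exact this _ heq _

theorem isStable (σ : Stab D) : σ.IsStable K := by
  obtain ⟨z, rfl⟩ := h.stabEquiv.surjective σ
  exact h.stab_isStable z

end IsLocalHeart

end StandardDatum

lemma isLocalHomeomorph_cexp : IsLocalHomeomorph Complex.exp := by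
  refine IsLocalHomeomorph.mk _ fun z => ?_
  have hd : HasStrictDerivAt Complex.exp (Complex.exp z) z := Complex.hasStrictDerivAt_exp z
  exact ⟨(hd.hasStrictFDerivAt_equiv (Complex.exp_ne_zero z)).toOpenPartialHomeomorph _,
    HasStrictFDerivAt.mem_toOpenPartialHomeomorph_source _, fun _ _ => rfl⟩

/-! ### The parametrisation by ℂ is a homeomorphism. -/

section Topology

variable {D : Type u₁} [Category.{v₁} D] [Preadditive D] [HasZeroObject D] [HasShift D ℤ]
  [∀ n : ℤ, (shiftFunctor D n).Additive] [Pretriangulated D]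
  {t : TStructure D} {K : D} {rk : K0 D →+ ℤ}

/-- The first factor carries the lowest cohomology of `E`, so φ⁺ is read off from the lowest degree,
which depends neither on the filtration nor on `z`. -/
lemma exists_of_isPhiPlus_stdDatum {z : ℂ} {E : D} {φ : ℝ}
    (hφ : IsPhiPlus (stdDatum t rk z).P E φ) :
    ∃ n : ℤ, φ = z.im / Real.pi + n ∧ t.IsGE E (-n) ∧ ¬ t.IsGE E (-n + 1) := by
  obtain ⟨H, h0, hne, rfl⟩ := hφ
  obtain ⟨n, hn, hdeg⟩ := (H.mem ⟨0, h0⟩).resolve_left (hne _)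
  have hlt (j : Fin H.n) (hj : 0 < j.1) : t.IsGE (H.factor j) (-n + 1) := by
    obtain ⟨m, hm, hdeg'⟩ := (H.mem j).resolve_left (hne _)
    have h1 : H.phase j < H.phase ⟨0, h0⟩ := H.phase_strictAnti hj
    rw [hm, hn] at h1
    have h2 : m < n := by exact_mod_cast (add_lt_add_iff_left _).1 h1
    have := hdeg'.2
    exact t.isGE_of_ge _ _ (-m)
  suffices key : ∀ (i : ℕ) (hi : i + 1 < H.n + 1), t.IsGE (H.obj ⟨i + 1, hi⟩) (-n) ∧
      ¬ t.IsGE (H.obj ⟨i + 1, hi⟩) (-n + 1) by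
    obtain ⟨h1, h2⟩ := key (H.n - 1) (by lia)
    have heq : (⟨H.n - 1 + 1, by lia⟩ : Fin (H.n + 1)) = Fin.last H.n :=
      Fin.ext (Nat.sub_add_cancel h0)
    rw [heq] at h1 h2
    exact ⟨n, hn, t.isGE_of_iso H.lastIso _, fun h => h2 (t.isGE_of_iso H.lastIso.symm _)⟩
  intro i
  induction i with
  | zero =>
    intro hi
    have : IsIso (H.π ⟨0, h0⟩) :=
      (Triangle.isZero₁_iff_isIso₂ _ (H.triangle ⟨0, h0⟩)).1 H.isZero_zero
    let e : H.obj ⟨0 + 1, hi⟩ ≅ H.factor ⟨0, h0⟩ := asIso (H.π ⟨0, h0⟩)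
    have := hdeg.1
    have := hdeg.2
    refine ⟨t.isGE_of_iso e.symm _, fun h1 => hne ⟨0, h0⟩ ?_⟩
    have := t.isGE_of_iso e (-n + 1)
    exact t.isZero _ (-n) (-n + 1)
  | succ i ih =>
    intro hi
    obtain ⟨h1, h2⟩ := ih (by lia)
    let k : Fin H.n := ⟨i + 1, by lia⟩
    have h3 : t.IsGE (H.factor k) (-n + 1) := hlt k (Nat.succ_pos i)
    refine ⟨t.isGE₂ _ (H.triangle k) (-n) h1 (t.isGE_of_ge (H.factor k) _ (-n + 1)),
      fun h4 => h2 ?_⟩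
    -- The previous step lies between the factor shifted by -1, in degrees ≥ `-n + 2`, and the
    -- current step.
    refine t.isGE₂ _ (inv_rot_of_distTriang _ (H.triangle k)) (-n + 1) ?_ h4
    have : t.IsGE ((H.factor k)⟦(-1 : ℤ)⟧) (-n + 2) := t.isGE_shift _ (-n + 1) _ _ (by lia)
    exact t.isGE_of_ge ((H.factor k)⟦(-1 : ℤ)⟧) (-n + 1) (-n + 2)

/-- Dually, the last factor carries the highest cohomology: all steps before the end lie in degrees
≤ `-n - 1`. -/
lemma exists_of_isPhiMinus_stdDatum {z : ℂ} {E : D} {φ : ℝ}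
    (hφ : IsPhiMinus (stdDatum t rk z).P E φ) :
    ∃ n : ℤ, φ = z.im / Real.pi + n ∧ t.IsLE E (-n) ∧ ¬ t.IsLE E (-n - 1) := by
  obtain ⟨H, h0, hne, rfl⟩ := hφ
  let l : Fin H.n := ⟨H.n - 1, Nat.sub_lt h0 one_pos⟩
  obtain ⟨n, hn, hdeg⟩ := (H.mem l).resolve_left (hne _)
  have key (i : ℕ) (hi : i < H.n) : t.IsLE (H.obj ⟨i, by lia⟩) (-n - 1) := by
    induction i with
    | zero => exact t.isLE_of_isZero H.isZero_zero _
    | succ i ih =>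
      let k : Fin H.n := ⟨i, by lia⟩
      refine t.isLE₂ _ (H.triangle k) (-n - 1) (ih (by lia)) ?_
      obtain ⟨m, hm, hdeg'⟩ := (H.mem k).resolve_left (hne _)
      have h1 : H.phase l < H.phase k := H.phase_strictAnti (show i < H.n - 1 by lia)
      rw [hm, hn] at h1
      have h2 : n < m := by exact_mod_cast (add_lt_add_iff_left _).1 h1
      have := hdeg'.1
      exact t.isLE_of_le (H.factor k) (-m) _
  have hl : t.IsLE (H.obj l.castSucc) (-n - 1) := key (H.n - 1) (by lia)
  have heq : l.succ = Fin.last H.n := Fin.ext (Nat.sub_add_cancel h0)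
  let e : H.obj l.succ ≅ E := eqToIso (congrArg H.obj heq) ≪≫ H.lastIso
  have h1 : t.IsLE (H.obj l.succ) (-n) :=
    t.isLE₂ _ (H.triangle l) (-n) (t.isLE_of_le (H.obj l.castSucc) (-n - 1) _) hdeg.1
  refine ⟨n, hn, t.isLE_of_iso e _, fun h2 => hne l ?_⟩
  have h3 : t.IsLE (H.obj l.succ) (-n - 1) := t.isLE_of_iso e.symm _
  have h4 : t.IsLE ((H.obj l.castSucc)⟦(1 : ℤ)⟧) (-n - 2) := t.isLE_shift _ (-n - 1) _ _ (by lia)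
  have h5 : t.IsLE (H.factor l) (-n - 1) :=
    t.isLE₂ _ (rot_of_distTriang _ (H.triangle l)) (-n - 1) h3
      (t.isLE_of_le ((H.obj l.castSucc)⟦(1 : ℤ)⟧) (-n - 2) _)
  have := hdeg.2
  exact t.isZero _ (-n - 1) (-n)

lemma phase_sub_of_isPhiPlus {z w : ℂ} {E : D} {φ ψ : ℝ}
    (hφ : IsPhiPlus (stdDatum t rk z).P E φ) (hψ : IsPhiPlus (stdDatum t rk w).P E ψ) :
    φ - ψ = z.im / Real.pi - w.im / Real.pi := by
  obtain ⟨m, rfl, hm, hm'⟩ := exists_of_isPhiPlus_stdDatum hφ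
  obtain ⟨n, rfl, hn, hn'⟩ := exists_of_isPhiPlus_stdDatum hψ
  obtain rfl : m = n := by
    rcases lt_trichotomy m n with h | h | h
    · exact (hn' (t.isGE_of_ge E _ (-m))).elim
    · exact h
    · exact (hm' (t.isGE_of_ge E _ (-n))).elim
  ring

lemma phase_sub_of_isPhiMinus {z w : ℂ} {E : D} {φ ψ : ℝ}
    (hφ : IsPhiMinus (stdDatum t rk z).P E φ) (hψ : IsPhiMinus (stdDatum t rk w).P E ψ) :
    φ - ψ = z.im / Real.pi - w.im / Real.pi := by
  obtain ⟨m, rfl, hm, hm'⟩ := exists_of_isPhiMinus_stdDatum hφ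
  obtain ⟨n, rfl, hn, hn'⟩ := exists_of_isPhiMinus_stdDatum hψ
  obtain rfl : m = n := by
    rcases lt_trichotomy m n with h | h | h
    · exact (hm' (t.isLE_of_le E (-n) _)).elim
    · exact h
    · exact (hn' (t.isLE_of_le E (-m) _)).elim
  ring

namespace IsLocalHeart

variable (h : IsLocalHeart t K rk)

include h

lemma stdDatum_P_self (z : ℂ) : (stdDatum t rk z).P (z.im / Real.pi) K := by
  simpa using (stdDatum_P_iff (t := t) (rk := rk) z 0 K).2 (by simpa using h.degree_zero)

/-- Changing `z` moves all extremal phases by the same amount; `K` shows that the supremum is not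
empty. -/
lemma slicingDist_stdDatum (z w : ℂ) :
    slicingDist (stdDatum t rk z).P (stdDatum t rk w).P =
      edist (z.im / Real.pi) (w.im / Real.pi) := by
  have hedist {φ ψ : ℝ} (h : φ - ψ = z.im / Real.pi - w.im / Real.pi) :
      edist φ ψ = edist (z.im / Real.pi) (w.im / Real.pi) := by
    rw [edist_dist, edist_dist, Real.dist_eq, Real.dist_eq, h]
  refine le_antisymm (sup_le ?_ ?_) (le_sup_of_le_left ?_)
  · exact iSup_le fun E => iSup₂_le fun φ ψ => iSup₂_le fun hφ hψ =>
      (hedist (phase_sub_of_isPhiPlus hφ hψ)).le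
  · exact iSup_le fun E => iSup₂_le fun φ ψ => iSup₂_le fun hφ hψ =>
      (hedist (phase_sub_of_isPhiMinus hφ hψ)).le
  · exact le_iSup_of_le K (le_iSup₂_of_le _ _ (le_iSup₂_of_le
      (isPhiPlus_of_mem (h.stdDatum_P_self z) h.not_isZero)
      (isPhiPlus_of_mem (h.stdDatum_P_self w) h.not_isZero) le_rfl))

/-- All charges are multiples of the rank, which is nonzero on nonzero semistable objects, so the
ratio is constant. -/
lemma chargeNorm_stdDatum (z w : ℂ) :
    chargeNorm (stdDatum t rk z) ((stdDatum t rk w).Z - (stdDatum t rk z).Z) =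
      ‖Complex.exp w - Complex.exp z‖ₑ / ‖Complex.exp z‖ₑ := by
  have key (E : D) (hE : rk (K0.cls E) ≠ 0) :
      ‖((stdDatum t rk w).Z - (stdDatum t rk z).Z) (K0.cls E)‖ₑ /
        ‖(stdDatum t rk z).Z (K0.cls E)‖ₑ =
      ‖Complex.exp w - Complex.exp z‖ₑ / ‖Complex.exp z‖ₑ := by
    rw [AddMonoidHom.sub_apply, stdDatum_Z, stdDatum_Z, ← mul_sub, enorm_mul, enorm_mul]
    exact ENNReal.mul_div_mul_left _ _ (by simpa using hE) enorm_ne_top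
  refine le_antisymm (iSup₂_le fun φ E => iSup₂_le fun hE hE' => ?_) ?_
  · obtain ⟨n, -, hn⟩ := hE.resolve_left hE'
    obtain ⟨r, hr, hr'⟩ := h.rk_degree hn hE'
    refine (key E ?_).le
    rw [hr']
    exact mul_ne_zero (Units.ne_zero _) hr.ne'
  · exact le_iSup₂_of_le _ K (le_iSup₂_of_le (h.stdDatum_P_self z) h.not_isZero
      (key K (by simp [h.rk_eq_one])).ge)

variable [IsTriangulated D]

lemma stab_mem_basicNhd_iff (z w : ℂ) (ε : ℝ) : h.stab w ∈ (h.stab z).basicNhd ε ↔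
    ‖Complex.exp w - Complex.exp z‖ₑ / ‖Complex.exp z‖ₑ <
        ENNReal.ofReal (Real.sin (Real.pi * ε)) ∧
      edist (z.im / Real.pi) (w.im / Real.pi) < ENNReal.ofReal ε := by
  rw [← h.chargeNorm_stdDatum z w, ← h.slicingDist_stdDatum z w]
  rfl

lemma continuous_stab : Continuous h.stab := by
  refine continuous_generateFrom_iff.2 ?_
  rintro _ ⟨σ, ε, -, -, rfl⟩
  obtain ⟨z, rfl⟩ := h.stabEquiv.surjective σ
  have : h.stab ⁻¹' ((h.stabEquiv z).basicNhd ε) =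
      { w | ‖Complex.exp w - Complex.exp z‖ₑ / ‖Complex.exp z‖ₑ <
        ENNReal.ofReal (Real.sin (Real.pi * ε)) } ∩
      { w | edist (z.im / Real.pi) (w.im / Real.pi) < ENNReal.ofReal ε } :=
    Set.ext fun w => h.stab_mem_basicNhd_iff z w ε
  rw [this]
  refine (isOpen_lt ?_ continuous_const).inter (isOpen_lt ?_ continuous_const)
  · exact (ENNReal.continuous_div_const _ (by simp [Complex.exp_ne_zero])).comp
      (continuous_enorm.comp (Complex.continuous_exp.sub continuous_const))
  · exact continuous_const.edist (Complex.continuous_im.div_const _)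

/-- The norm condition puts exp (w - z) near 1 and the slicing condition puts Im (w - z) in (-π, π).
Hence w - z is the principal logarithm of exp (w - z), which is small by continuity at 1. -/
lemma exists_basicNhd_subset {z : ℂ} {U : Set ℂ} (hU : U ∈ nhds z) :
    ∃ ε : ℝ, 0 < ε ∧ ε < 1 / 8 ∧ ∀ w, h.stab w ∈ (h.stab z).basicNhd ε → w ∈ U := by
  obtain ⟨r, hr, hrU⟩ := Metric.mem_nhds_iff.1 hU
  have hlog : ContinuousAt Complex.log 1 := continuousAt_clog (by simp)
  obtain ⟨δ, hδ, hδ'⟩ := Metric.continuousAt_iff.1 hlog r hr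
  have hπ := Real.pi_pos
  -- The bound 1/16 keeps `ε < 1/8` and |Im (w - z)| < π; the bound `δ / π` gives sin (πε) ≤ πε ≤
  -- `δ`.
  refine ⟨min (1 / 16) (δ / Real.pi), lt_min (by norm_num) (by positivity),
    (min_le_left _ _).trans_lt (by norm_num), fun w hw => hrU ?_⟩
  set ε := min (1 / 16) (δ / Real.pi)
  have hε : 0 < ε := lt_min (by norm_num) (by positivity)
  rw [h.stab_mem_basicNhd_iff] at hw
  obtain ⟨h1, h2⟩ := hw
  have h3 : ‖Complex.exp (w - z) - 1‖ < δ := by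
    have h4 : ‖Complex.exp w - Complex.exp z‖ₑ / ‖Complex.exp z‖ₑ =
        ‖Complex.exp (w - z) - 1‖ₑ := by
      have : Complex.exp w - Complex.exp z = (Complex.exp (w - z) - 1) * Complex.exp z := by
        rw [sub_mul, one_mul, ← Complex.exp_add, sub_add_cancel]
      rw [this, enorm_mul]
      exact ENNReal.mul_div_cancel_right (by simp [Complex.exp_ne_zero]) enorm_ne_top
    rw [h4, ← ofReal_norm, ENNReal.ofReal_lt_ofReal_iff_of_nonneg (norm_nonneg _)] at h1
    calc _ < Real.sin (Real.pi * ε) := h1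
      _ ≤ Real.pi * ε := Real.sin_le (by positivity)
      _ ≤ Real.pi * (δ / Real.pi) := by gcongr; exact min_le_right _ _
      _ = δ := by field_simp
  have h4 : |(w - z).im| < Real.pi := by
    rw [edist_comm, edist_dist, ENNReal.ofReal_lt_ofReal_iff hε, Real.dist_eq, ← sub_div, abs_div,
      abs_of_pos hπ, div_lt_iff₀ hπ] at h2
    calc |(w - z).im| < ε * Real.pi := h2
      _ ≤ 1 / 16 * Real.pi := by gcongr; exact min_le_left _ _
      _ < Real.pi := by linarith
  have h5 := hδ' (x := Complex.exp (w - z)) (by rwa [dist_eq_norm])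
  rw [Complex.log_exp (abs_lt.1 h4).1 (abs_lt.1 h4).2.le, Complex.log_one, dist_zero_right] at h5
  rwa [Metric.mem_ball, dist_eq_norm]

/-- The homeomorphism between `ℂ` and the space of stability conditions. -/
def stabHomeomorph : ℂ ≃ₜ Stab D :=
  h.stabEquiv.toHomeomorphOfContinuousOpen h.continuous_stab fun U hU => by
    refine isOpen_iff_mem_nhds.2 ?_
    rintro _ ⟨z, hz, rfl⟩
    obtain ⟨ε, h0, h1, hε⟩ := h.exists_basicNhd_subset (hU.mem_nhds hz)
    have hopen : IsOpen ((h.stab z).basicNhd ε) :=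
      TopologicalSpace.isOpen_generateFrom_of_mem ⟨_, _, h0, h1, rfl⟩
    have hmem : h.stab z ∈ (h.stab z).basicNhd ε := by
      rw [h.stab_mem_basicNhd_iff]
      have : 0 < Real.sin (Real.pi * ε) :=
        Real.sin_pos_of_pos_of_lt_pi (mul_pos Real.pi_pos h0)
          (by nlinarith [Real.pi_pos])
      simp [h0, this]
    refine Filter.mem_of_superset (hopen.mem_nhds hmem) fun σ hσ => ?_
    obtain ⟨w, rfl⟩ := h.stabEquiv.surjective σ
    exact ⟨w, hε w hσ, rfl⟩

@[simp]
lemma stabHomeomorph_apply (z : ℂ) : h.stabHomeomorph z = h.stab z := rfl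

/-- The value of the central charge at `K` is a coordinate on `Hom(K₀(D), ℂ)`. -/
def chargeEquiv : (K0 D →+ ℂ) ≃ₗ[ℂ] (Fin 1 → ℂ) where
  toFun Z := fun _ => Z (K0.cls K)
  invFun c := (AddMonoidHom.mulRight (c 0)).comp ((Int.castAddHom ℂ).comp rk)
  map_add' _ _ := rfl
  map_smul' _ _ := rfl
  left_inv Z := by
    refine DFunLike.ext _ _ fun x => ?_
    conv_rhs => rw [h.eq_smul x, map_zsmul, zsmul_eq_mul]
    rfl
  right_inv c := by
    ext i
    obtain rfl := Subsingleton.elim i 0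
    simp [h.rk_eq_one]

/-- The coordinate on the space of stability conditions given by the central charge of `K`. -/
def periodCoordinates : PeriodCoordinates D where
  n := 1
  coord := h.chargeEquiv
  isLocalHomeomorph := by
    let e : ℂ ≃ₜ (Fin 1 → ℂ) := (Homeomorph.funUnique (Fin 1) ℂ).symm
    have : (fun σ : Stab D => h.chargeEquiv σ.1.Z) =
        e ∘ Complex.exp ∘ h.stabHomeomorph.symm := by
      funext σ
      obtain ⟨z, rfl⟩ := h.stabHomeomorph.surjective σ
      ext i
      rw [Function.comp_apply, Function.comp_apply, Homeomorph.symm_apply_apply]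
      simp [chargeEquiv, h.rk_eq_one, e]
    rw [this]
    exact e.isLocalHomeomorph.comp
      (isLocalHomeomorph_cexp.comp h.stabHomeomorph.symm.isLocalHomeomorph)

end IsLocalHeart

end Topology

/-! ### Holomorphy in charts given by local homeomorphisms. -/

section LocalHomeomorph

variable {E E' X X' : Type*} [NormedAddCommGroup E] [NormedSpace ℂ E] [NormedAddCommGroup E']
  [NormedSpace ℂ E'] [TopologicalSpace X] [TopologicalSpace X']

/-- The charts are restrictions of `f` and `f'`, so in charts `Φ` is a restriction of the linear map
`L`. -/
lemma contMDiff_of_isLocalHomeomorph {f : X → E} (hf : IsLocalHomeomorph f) {f' : X' → E'}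
    (hf' : IsLocalHomeomorph f') {Φ : X → X'} (hΦ : Continuous Φ) (L : E →L[ℂ] E')
    (hL : ∀ x, f' (Φ x) = L (f x)) :
    letI := chartedSpaceOfIsLocalHomeomorph f hf
    letI := chartedSpaceOfIsLocalHomeomorph f' hf'
    ContMDiff 𝓘(ℂ, E) 𝓘(ℂ, E') ω Φ := by
  let := chartedSpaceOfIsLocalHomeomorph f hf
  let := chartedSpaceOfIsLocalHomeomorph f' hf'
  intro x
  refine ⟨hΦ.continuousWithinAt, ?_⟩
  have hx : (hf x).choose x ∈ (hf x).choose.target :=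
    (hf x).choose.map_source (hf x).choose_spec.1
  have heq {y : E} (hy : y ∈ (hf x).choose.target) :
      (hf' (Φ x)).choose (Φ ((hf x).choose.symm y)) = L y := by
    rw [← (hf' (Φ x)).choose_spec.2, hL]
    exact congrArg L ((congrFun (hf x).choose_spec.2 _).trans ((hf x).choose.right_inv hy))
  exact (L.contDiff.contDiffWithinAt.congr_of_eventuallyEq_of_mem
    (Filter.mem_of_superset (mem_nhdsWithin_of_mem_nhds ((hf x).choose.open_target.mem_nhds hx))
      fun y hy => heq hy) (by simp))

end LocalHomeomorph

/-! ### Comparison of two local hearts along a functor. -/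

section Functor

variable {D : Type u₁} [Category.{v₁} D] [Preadditive D] [HasZeroObject D] [HasShift D ℤ]
  [∀ n : ℤ, (shiftFunctor D n).Additive] [Pretriangulated D] [IsTriangulated D]
  {D' : Type u₂} [Category.{v₂} D'] [Preadditive D'] [HasZeroObject D'] [HasShift D' ℤ]
  [∀ n : ℤ, (shiftFunctor D' n).Additive] [Pretriangulated D'] [IsTriangulated D']

/-- A functor between triangulated categories with local hearts that preserves and detects the
degrees of objects and maps the simple object to the simple object. -/
structure IsLocalHeart.IsCompatible (F : D ⥤ D') (t : TStructure D) (K : D) (t' : TStructure D')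
    (K' : D') : Prop where
  isLE_iff (X : D) (n : ℤ) : t'.IsLE (F.obj X) n ↔ t.IsLE X n
  isGE_iff (X : D) (n : ℤ) : t'.IsGE (F.obj X) n ↔ t.IsGE X n
  nonempty_iso : Nonempty (F.obj K ≅ K')

namespace IsLocalHeart

variable {t : TStructure D} {K : D} {rk : K0 D →+ ℤ} (h : IsLocalHeart t K rk)
  {t' : TStructure D'} {K' : D'} {rk' : K0 D' →+ ℤ} (h' : IsLocalHeart t' K' rk')
  {F : D ⥤ D'} [F.CommShift ℤ] [F.IsTriangulated] (hF : IsCompatible F t K t' K')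

include hF in
omit [IsTriangulated D] [IsTriangulated D'] [F.CommShift ℤ] [F.IsTriangulated] in
lemma IsCompatible.isZero_iff (X : D) : IsZero (F.obj X) ↔ IsZero X := by
  refine ⟨fun hX => ?_, fun hX => ?_⟩
  · have := (hF.isLE_iff X 0).1 (t'.isLE_of_isZero hX 0)
    have := (hF.isGE_iff X 1).1 (t'.isGE_of_isZero hX 1)
    exact t.isZero X 0 1
  · have := (hF.isLE_iff X 0).2 (t.isLE_of_isZero hX 0)
    have := (hF.isGE_iff X 1).2 (t.isGE_of_isZero hX 1)
    exact t'.isZero (F.obj X) 0 1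

include h h' hF in
omit [IsTriangulated D'] in
-- The parameter is unchanged: slicings agree because `F` detects degrees and zero objects, charges
-- because they agree on the generator `K`.
lemma pullback_stdDatum (z : ℂ) : (stdDatum t' rk' z).pullback F = stdDatum t rk z := by
  refine Datum.ext (DFunLike.ext _ _ fun x => ?_) ?_
  · obtain ⟨e⟩ := hF.nonempty_iso
    change (stdDatum t' rk' z).Z (K0.map F x) = _
    conv_lhs => rw [h.eq_smul x, map_zsmul, K0.map_cls, K0.cls_eq_of_iso e, map_zsmul, stdDatum_Z,
      h'.rk_eq_one, zsmul_eq_mul, Int.cast_one, one_mul]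
    rfl
  · ext ψ X
    exact or_congr (hF.isZero_iff X) (exists_congr fun n => and_congr_right fun _ =>
      and_congr (hF.isLE_iff X _) (hF.isGE_iff X _))

include h h' hF in
lemma dom_eq_univ : Dom F = Set.univ := by
  refine Set.eq_univ_of_forall fun σ => ?_
  obtain ⟨z, rfl⟩ := h'.stabEquiv.surjective σ
  have := (h.stab z).2
  rw [h.stab_val, ← h.pullback_stdDatum h' hF] at this
  exact this

/-- The homeomorphism between the spaces of stability conditions. -/
def stabHomeomorphOfCompatible : Stab D' ≃ₜ Stab D :=
  h'.stabHomeomorph.symm.trans h.stabHomeomorph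

@[simp]
lemma stabHomeomorphOfCompatible_stab (z : ℂ) :
    h.stabHomeomorphOfCompatible h' (h'.stab z) = h.stab z :=
  congrArg h.stabHomeomorph (h'.stabHomeomorph.symm_apply_apply z)

@[simp]
lemma stabHomeomorphOfCompatible_symm_stab (z : ℂ) :
    (h.stabHomeomorphOfCompatible h').symm (h.stab z) = h'.stab z :=
  congrArg h'.stabHomeomorph (h.stabHomeomorph.symm_apply_apply z)

include hF in
lemma stabHomeomorphOfCompatible_apply (σ : Dom F) :
    h.stabHomeomorphOfCompatible h' σ = inducedMap F σ := by
  obtain ⟨σ, hσ⟩ := σ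
  obtain ⟨z, rfl⟩ := h'.stabHomeomorph.surjective σ
  simp only [stabHomeomorph_apply, stabHomeomorphOfCompatible_stab]
  exact Subtype.ext (h.pullback_stdDatum h' hF z).symm

omit [IsTriangulated D] [IsTriangulated D'] in
/-- A continuous map between spaces of stability conditions is holomorphic if it is given on
central charges by a homomorphism of Grothendieck groups. -/
lemma contMDiff_of_charge (c : PeriodCoordinates D) (c' : PeriodCoordinates D')
    {Φ : Stab D → Stab D'} (hΦ : Continuous Φ) (f : K0 D' →+ K0 D)
    (hf : ∀ σ, (Φ σ).1.Z = σ.1.Z.comp f) :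
    letI := c.chartedSpace
    letI := c'.chartedSpace
    ContMDiff 𝓘(ℂ, Fin c.n → ℂ) 𝓘(ℂ, Fin c'.n → ℂ) ω Φ := by
  let g : (K0 D →+ ℂ) →ₗ[ℂ] (K0 D' →+ ℂ) :=
    { toFun := fun Z => Z.comp f
      map_add' := fun _ _ => rfl
      map_smul' := fun _ _ => rfl }
  refine contMDiff_of_isLocalHomeomorph c.isLocalHomeomorph c'.isLocalHomeomorph hΦ
    (LinearMap.toContinuousLinearMap (c'.coord.toLinearMap ∘ₗ g ∘ₗ c.coord.symm.toLinearMap))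
    fun σ => ?_
  simp [hf, g]

lemma isBiholomorphic (c : PeriodCoordinates D') (c' : PeriodCoordinates D) :
    IsBiholomorphic c c' (h.stabHomeomorphOfCompatible h') := by
  -- Equal parameters mean that charges correspond under the isomorphism of K₀ matching the
  -- generators `K` and `K'`, written through the ranks.
  refine ⟨contMDiff_of_charge c c' (Homeomorph.continuous _)
    ((zmultiplesHom (K0 D') (K0.cls K')).comp rk) fun σ => ?_,
    contMDiff_of_charge c' c (Homeomorph.continuous _)
    ((zmultiplesHom (K0 D) (K0.cls K)).comp rk') fun σ => ?_⟩
  · obtain ⟨z, rfl⟩ := h'.stabHomeomorph.surjective σ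
    refine DFunLike.ext _ _ fun x => ?_
    simp [h'.rk_eq_one]
  · obtain ⟨z, rfl⟩ := h.stabHomeomorph.surjective σ
    refine DFunLike.ext _ _ fun x => ?_
    simp [h.rk_eq_one]

end IsLocalHeart

end Functor

/-! ### Abelian categories with a length and one simple object. -/

section Length

variable {C : Type u₁} [Category.{v₁} C]

/-- On subobjects of `E`, `μ` is strictly increasing, which rules out infinite descent; the colength
`μ E - μ S` is strictly decreasing, which rules out infinite ascent. -/
lemma finiteLength_of_length [HasZeroMorphisms C] (μ : C → ℕ)
    (hle : ∀ {X Y : C} (f : X ⟶ Y) [Mono f], μ X ≤ μ Y)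
    (hlt : ∀ {X Y : C} (f : X ⟶ Y) [Mono f], ¬ IsIso f → μ X < μ Y) : FiniteLength C := by
  intro E
  have hmono : StrictMono (fun S : StrictSubobject E => μ (S.1 : C)) := fun S T hST => by
    have : Mono (Subobject.ofLE S.1 T.1 hST.le) := mono_of_mono_fac (Subobject.ofLE_arrow _)
    refine hlt (Subobject.ofLE S.1 T.1 hST.le) fun hiso => hST.not_ge ?_
    exact Subobject.le_of_comm (inv (Subobject.ofLE S.1 T.1 hST.le))
      ((IsIso.inv_comp_eq _).2 (Subobject.ofLE_arrow _).symm)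
  refine ⟨hmono.wellFoundedLT, ?_⟩
  have hanti : StrictAnti (fun S : StrictSubobject E => μ E - μ (S.1 : C)) := fun S T hST => by
    have h1 : μ (S.1 : C) < μ (T.1 : C) := hmono hST
    have h2 : μ (S.1 : C) ≤ μ E := hle S.1.arrow
    have h3 : μ (T.1 : C) ≤ μ E := hle T.1.arrow
    dsimp only
    lia
  exact hanti.wellFoundedGT

/-- `ℓ` is the length on an abelian category of finite length, and `k` is its unique simple
object. -/
structure IsLocalLength [Abelian C] (k : C) (ℓ : C → ℕ) : Prop where
  add (S : ShortComplex C) : S.ShortExact → ℓ S.X₂ = ℓ S.X₁ + ℓ S.X₃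
  pos (X : C) : ¬ IsZero X → 0 < ℓ X
  eq_one : ℓ k = 1
  exists_epi (X : C) : ¬ IsZero X → ∃ f : X ⟶ k, Epi f
  exists_mono (X : C) : ¬ IsZero X → ∃ f : k ⟶ X, Mono f

namespace IsLocalLength

variable [Abelian C] {k : C} {ℓ : C → ℕ} (h : IsLocalLength k ℓ)

include h

lemma eq_zero {X : C} (hX : IsZero X) : ℓ X = 0 := by
  have := h.add (ShortComplex.mk (0 : X ⟶ X) (0 : X ⟶ X) comp_zero)
    { exact := ShortComplex.exact_of_isZero_X₂ _ hX
      mono_f := ⟨fun _ _ _ => hX.eq_of_tgt _ _⟩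
      epi_g := ⟨fun _ _ _ => hX.eq_of_src _ _⟩ }
  dsimp only at this
  lia

lemma isZero_of_eq_zero {X : C} (hX : ℓ X = 0) : IsZero X := by
  by_contra h0
  exact (h.pos X h0).ne' hX

lemma add_cokernel {X Y : C} (f : X ⟶ Y) [Mono f] : ℓ Y = ℓ X + ℓ (cokernel f) :=
  h.add (ShortComplex.mk f (cokernel.π f) (cokernel.condition f))
    { exact := ShortComplex.exact_cokernel f }

lemma eq_of_iso {X Y : C} (e : X ≅ Y) : ℓ X = ℓ Y := by
  rw [h.add_cokernel e.hom, h.eq_zero (isZero_cokernel_of_epi e.hom), add_zero]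

lemma le_of_mono {X Y : C} (f : X ⟶ Y) [Mono f] : ℓ X ≤ ℓ Y := by
  rw [h.add_cokernel f]
  exact Nat.le_add_right _ _

lemma lt_of_mono {X Y : C} (f : X ⟶ Y) [Mono f] (hf : ¬ IsIso f) : ℓ X < ℓ Y := by
  rw [h.add_cokernel f]
  refine Nat.lt_add_of_pos_right (h.pos _ fun h0 => hf ?_)
  have : Epi f := Preadditive.epi_of_isZero_cokernel f h0
  exact isIso_of_mono_of_epi f

lemma not_isZero : ¬ IsZero k := fun hk => by
  have := h.eq_one
  rw [h.eq_zero hk] at this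
  lia

/-- Rank-nullity: by exactness the kernel of the second map is the image of the first. -/
lemma eq_rank_add_rank {S : ShortComplex C} (hS : S.Exact) :
    ℓ S.X₂ = ℓ (Abelian.image S.f) + ℓ (Abelian.image S.g) := by
  have e : Abelian.image S.f ≅ kernel S.g :=
    hS.isLimitImage.conePointUniqueUpToIso (limit.isLimit _)
  rw [h.eq_of_iso e, ← h.eq_of_iso (Abelian.coimageIsoImage S.g)]
  exact h.add_cokernel (kernel.ι S.g)

lemma rank_eq_zero_of_src {X Y : C} (f : X ⟶ Y) (hX : IsZero X) : ℓ (Abelian.image f) = 0 := by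
  rw [← h.eq_of_iso (Abelian.coimageIsoImage f)]
  exact h.eq_zero (IsZero.of_epi (cokernel.π (kernel.ι f)) hX)

lemma finiteLength_of_isEquivalence {A : Type u₂} [Category.{v₂} A] [HasZeroMorphisms A]
    (G : A ⥤ C) [G.IsEquivalence] : FiniteLength A :=
  finiteLength_of_length (fun X => ℓ (G.obj X)) (fun f _ => h.le_of_mono (G.map f)) fun f _ hf =>
    h.lt_of_mono (G.map f) fun _ => hf (isIso_of_reflects_iso f G)

lemma simple_of_isEquivalence {A : Type u₂} [Category.{v₂} A] [HasZeroMorphisms A]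
    (G : A ⥤ C) [G.IsEquivalence] {X : A} (hX : Nonempty (G.obj X ≅ k)) : Simple X where
  mono_isIso_iff_nonzero {Y} f _ := by
    obtain ⟨e⟩ := hX
    have hX0 : ¬ IsZero X := fun h0 => h.not_isZero ((G.map_isZero h0).of_iso e.symm)
    refine ⟨fun _ hf => ?_, fun hf => ?_⟩
    · subst hf
      refine hX0 ((IsZero.iff_id_eq_zero X).2 ?_)
      rw [← IsIso.inv_hom_id (0 : Y ⟶ X), comp_zero]
    · by_contra hiso
      have h1 := h.lt_of_mono (G.map f) fun _ => hiso (isIso_of_reflects_iso f G)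
      rw [h.eq_of_iso e, h.eq_one, Nat.lt_one_iff] at h1
      have h2 := h.isZero_of_eq_zero h1
      exact hf (G.map_injective (h2.eq_of_src _ _))

end IsLocalLength

end Length

/-! ### The standard heart of the bounded derived category. -/

section Derived

variable {C : Type u₁} [Category.{v₁} C] [Abelian C] [HasDerivedCategory.{w} C]

open DerivedCategory

variable (C) in
/-- The t-structure on the bounded derived category. -/
abbrev tBounded : TStructure (DerivedCategory.Bounded C) := TStructure.t.onBounded

lemma tBounded_isLE_iff (X : DerivedCategory.Bounded C) (n : ℤ) :
    (tBounded C).IsLE X n ↔ X.obj.IsLE n := ObjectProperty.tStructure_isLE_iff _ _ _ _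

lemma tBounded_isGE_iff (X : DerivedCategory.Bounded C) (n : ℤ) :
    (tBounded C).IsGE X n ↔ X.obj.IsGE n := ObjectProperty.tStructure_isGE_iff _ _ _ _

lemma degree_tBounded_iff (X : DerivedCategory.Bounded C) (n : ℤ) :
    degree (tBounded C) n X ↔ X.obj.IsLE n ∧ X.obj.IsGE n :=
  and_congr (tBounded_isLE_iff X n) (tBounded_isGE_iff X n)

/-- A cone of `f` formed in the bounded category is isomorphic to the given third object, which
transfers the relation. -/
lemma K0.cls_of_distTriang_derived {X Y Z : DerivedCategory.Bounded C} (f : X.obj ⟶ Y.obj)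
    (g : Y.obj ⟶ Z.obj) (δ : Z.obj ⟶ X.obj⟦(1 : ℤ)⟧) (hT : Triangle.mk f g δ ∈ distTriang _) :
    K0.cls Y = K0.cls X + K0.cls Z := by
  obtain ⟨Z', g', δ', hT'⟩ := distinguished_cocone_triangle (ObjectProperty.homMk f : X ⟶ Y)
  have e := isoTriangleOfIso₁₂ _ _ (Bounded.ι.map_distinguished _ hT') hT (Iso.refl _)
    (Iso.refl _) ((Category.comp_id _).trans (Category.id_comp _).symm)
  have e₃ : Z' ≅ Z := ObjectProperty.isoMk _ (Triangle.π₃.mapIso e)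
  rw [← K0.cls_eq_of_iso e₃]
  exact K0.cls_of_distTriang hT'

/-- The functor which sends an object of an abelian category to the corresponding object
of the bounded derived category that is concentrated in degree `n`. -/
def toDegree (C : Type u₁) [Category.{v₁} C] [Abelian C] [HasDerivedCategory.{w} C] (n : ℤ) :
    C ⥤ (degree (tBounded C) n).FullSubcategory :=
  ObjectProperty.lift _ (ObjectProperty.lift _ (singleFunctor C n)
    fun _ => ⟨⟨n, inferInstance⟩, ⟨n, inferInstance⟩⟩)
    fun M => (degree_tBounded_iff _ _).2 ⟨inferInstanceAs (((singleFunctor C n).obj M).IsLE n),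
      inferInstanceAs (((singleFunctor C n).obj M).IsGE n)⟩

instance (n : ℤ) : (toDegree C n).Full where
  map_surjective f := by
    obtain ⟨g, hg⟩ := (singleFunctor C n).map_surjective f.hom.hom
    exact ⟨g, ObjectProperty.hom_ext _ (ObjectProperty.hom_ext _ hg)⟩

instance (n : ℤ) : (toDegree C n).Faithful where
  map_injective h := (singleFunctor C n).map_injective (congrArg (fun f => f.hom.hom) h)

instance (n : ℤ) : (toDegree C n).EssSurj where
  mem_essImage X := by
    obtain ⟨h1, h2⟩ := (degree_tBounded_iff _ _).1 X.property
    obtain ⟨M, ⟨e⟩⟩ := exists_iso_singleFunctor_obj_of_isGE_of_isLE X.obj.obj n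
    exact ⟨M, ⟨ObjectProperty.isoMk _ (ObjectProperty.isoMk _ e.symm)⟩⟩

instance (n : ℤ) : (toDegree C n).IsEquivalence where

lemma exists_iso_inDegreeZero {X : DerivedCategory.Bounded C} (hX : degree (tBounded C) 0 X) :
    ∃ M : C, Nonempty (inDegreeZero M ≅ X) := by
  obtain ⟨M, ⟨e⟩⟩ := Functor.EssSurj.mem_essImage (F := toDegree C 0) ⟨X, hX⟩
  exact ⟨M, ⟨(degree (tBounded C) 0).ι.mapIso e⟩⟩

lemma degree_inDegreeZero (M : C) : degree (tBounded C) 0 (inDegreeZero M) :=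
  ((toDegree C 0).obj M).property

lemma isZero_inDegreeZero_iff (M : C) : IsZero (inDegreeZero M) ↔ IsZero M := by
  constructor
  · intro hM
    rw [IsZero.iff_id_eq_zero]
    refine (singleFunctor C 0).map_injective ?_
    rw [CategoryTheory.Functor.map_id, Functor.map_zero]
    exact (Bounded.ι.map_isZero hM).eq_of_src _ _
  · intro hM
    rw [IsZero.iff_id_eq_zero]
    exact ObjectProperty.hom_ext _ (((singleFunctor C 0).map_isZero hM).eq_of_src _ _)

/-- The Euler characteristic of an object of the bounded derived category, for a length on the
abelian category. -/
def eulerChar (ℓ : C → ℕ) (X : DerivedCategory.Bounded C) : ℤ :=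
  ∑ᶠ n : ℤ, (n.negOnePow : ℤ) * ℓ ((homologyFunctor C n).obj X.obj)

namespace IsLocalLength

variable {k : C} {ℓ : C → ℕ} (h : IsLocalLength k ℓ)

include h

lemma eulerChar_inDegreeZero (M : C) : eulerChar ℓ (inDegreeZero M) = ℓ M := by
  rw [eulerChar, finsum_eq_single _ 0]
  · have e : (homologyFunctor C 0).obj (inDegreeZero M).obj ≅ M :=
      (singleFunctorCompHomologyFunctorIso C 0).app M
    rw [h.eq_of_iso e]
    simp
  · intro n hn
    have : IsZero ((homologyFunctor C n).obj (inDegreeZero M).obj) := by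
      rcases hn.lt_or_gt with hn | hn
      · exact ((singleFunctor C 0).obj M).isZero_of_isGE 0 n hn
      · exact ((singleFunctor C 0).obj M).isZero_of_isLE 0 n hn
    simp [h.eq_zero this]

omit h in
-- Stated for any `f` vanishing with the homology, so that it covers the ranks of maps out of the
-- homology objects.
lemma finite_support (X : DerivedCategory.Bounded C) (f : ℤ → ℕ)
    (hf : ∀ n, IsZero ((homologyFunctor C n).obj X.obj) → f n = 0) :
    (Function.support fun n : ℤ => (n.negOnePow : ℤ) * (f n : ℤ)).Finite := by
  obtain ⟨⟨a, ha⟩, ⟨b, hb⟩⟩ := X.property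
  refine (Set.finite_Icc a b).subset fun n hn => ?_
  by_contra hn'
  refine hn ?_
  have : IsZero ((homologyFunctor C n).obj X.obj) := by
    rw [Set.mem_Icc, not_and_or, not_le, not_le] at hn'
    rcases hn' with hn' | hn'
    · exact X.obj.isZero_of_isGE a n hn'
    · exact X.obj.isZero_of_isLE b n hn'
  simp [hf n this]

/-- In the long exact homology sequence each length is the sum of the ranks of the adjacent maps,
and these ranks are what the alternating sums compare. -/
lemma eulerChar_of_distTriang (T : Triangle (DerivedCategory.Bounded C))
    (hT : T ∈ distTriang _) :
    eulerChar ℓ T.obj₂ = eulerChar ℓ T.obj₁ + eulerChar ℓ T.obj₃ := by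
  let T' := Bounded.ι.mapTriangle.obj T
  have hT' : T' ∈ distTriang _ := hT
  let a (n : ℤ) : ℕ := ℓ (Abelian.image ((homologyFunctor C n).map T'.mor₁))
  let b (n : ℤ) : ℕ := ℓ (Abelian.image ((homologyFunctor C n).map T'.mor₂))
  let c (n : ℤ) : ℕ := ℓ (Abelian.image (HomologySequence.δ T' n (n + 1) rfl))
  have h1 (n : ℤ) : ℓ ((homologyFunctor C (n + 1)).obj T.obj₁.obj) = c n + a (n + 1) :=
    h.eq_rank_add_rank (HomologySequence.exact₁ T' hT' n (n + 1) rfl)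
  have h2 (n : ℤ) : ℓ ((homologyFunctor C n).obj T.obj₂.obj) = a n + b n :=
    h.eq_rank_add_rank (HomologySequence.exact₂ T' hT' n)
  have h3 (n : ℤ) : ℓ ((homologyFunctor C n).obj T.obj₃.obj) = b n + c n :=
    h.eq_rank_add_rank (HomologySequence.exact₃ T' hT' n (n + 1) rfl)
  have ha := finite_support T.obj₁ a fun n hn => h.rank_eq_zero_of_src _ hn
  have hb := finite_support T.obj₂ b fun n hn => h.rank_eq_zero_of_src _ hn
  have hc := finite_support T.obj₃ c fun n hn => h.rank_eq_zero_of_src _ hn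
  have e2 : eulerChar ℓ T.obj₂ = ∑ᶠ n : ℤ, (n.negOnePow : ℤ) * (a n : ℤ) +
      ∑ᶠ n : ℤ, (n.negOnePow : ℤ) * (b n : ℤ) := by
    rw [← finsum_add_distrib ha hb]
    exact finsum_congr fun n => by rw [h2]; push_cast; ring
  have e3 : eulerChar ℓ T.obj₃ = ∑ᶠ n : ℤ, (n.negOnePow : ℤ) * (b n : ℤ) +
      ∑ᶠ n : ℤ, (n.negOnePow : ℤ) * (c n : ℤ) := by
    rw [← finsum_add_distrib hb hc]
    exact finsum_congr fun n => by rw [h3]; push_cast; ring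
  have e1 : eulerChar ℓ T.obj₁ = ∑ᶠ n : ℤ, (n.negOnePow : ℤ) * (a n : ℤ) -
      ∑ᶠ n : ℤ, (n.negOnePow : ℤ) * (c n : ℤ) := by
    -- The connecting map raises the degree by one; reindexing produces the sign needed.
    have ec : ∑ᶠ n : ℤ, (n.negOnePow : ℤ) * (c n : ℤ) =
        ∑ᶠ n : ℤ, -((n.negOnePow : ℤ) * (c (n - 1) : ℤ)) := by
      rw [← finsum_comp_equiv (Equiv.addRight (1 : ℤ))
        (f := fun n : ℤ => -((n.negOnePow : ℤ) * (c (n - 1) : ℤ)))]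
      exact finsum_congr fun n => by simp [Int.negOnePow_succ]
    have hc' : (Function.support fun n : ℤ => (n.negOnePow : ℤ) * (c (n - 1) : ℤ)).Finite := by
      refine (hc.image (· + 1)).subset fun n hn => ⟨n - 1, ?_, by simp⟩
      simpa using hn
    rw [ec, finsum_neg_distrib, sub_neg_eq_add, ← finsum_add_distrib ha hc']
    refine finsum_congr fun n => ?_
    have := h1 (n - 1)
    rw [sub_add_cancel] at this
    rw [this]
    push_cast
    ring
  rw [e1, e2, e3]
  ring

/-- The rank homomorphism on the Grothendieck group of the bounded derived category. -/
def rank : K0 (DerivedCategory.Bounded C) →+ ℤ :=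
  K0.lift (eulerChar ℓ) h.eulerChar_of_distTriang

lemma rank_inDegreeZero (M : C) : h.rank (K0.cls (inDegreeZero M)) = ℓ M := by
  rw [rank, K0.lift_cls, h.eulerChar_inDegreeZero]

/-- Induction on the length, splitting off a copy of `k` embedded in `M`. -/
lemma cls_inDegreeZero (M : C) :
    K0.cls (inDegreeZero M) = (ℓ M : ℤ) • K0.cls (inDegreeZero k) := by
  induction hn : ℓ M using Nat.strong_induction_on generalizing M with
  | _ n ih =>
    by_cases hM : IsZero M
    · rw [K0.cls_of_isZero ((isZero_inDegreeZero_iff M).2 hM), ← hn, h.eq_zero hM]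
      simp
    · obtain ⟨f, hf⟩ := h.exists_mono M hM
      have hS : (ShortComplex.mk f (cokernel.π f) (cokernel.condition f)).ShortExact :=
        { exact := ShortComplex.exact_cokernel f }
      have h1 := K0.cls_of_distTriang_derived (X := inDegreeZero k) (Y := inDegreeZero M)
        (Z := inDegreeZero (cokernel f)) _ _ _ hS.singleTriangle_distinguished
      have h2 := h.add_cokernel f
      rw [h.eq_one] at h2
      rw [h1, ih (ℓ (cokernel f)) (by lia) _ rfl, ← hn, h2]
      push_cast
      rw [add_smul, one_smul]

theorem isLocalHeart : IsLocalHeart (tBounded C) (inDegreeZero k) h.rank where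
  exists_isGE X := by
    obtain ⟨a, ha⟩ := X.property.1
    exact ⟨a, (tBounded_isGE_iff X a).2 ha⟩
  exists_isLE X := by
    obtain ⟨b, hb⟩ := X.property.2
    exact ⟨b, (tBounded_isLE_iff X b).2 hb⟩
  degree_zero := degree_inDegreeZero k
  rk_eq_one := by rw [h.rank_inDegreeZero, h.eq_one, Nat.cast_one]
  rk_pos X hX hX' := by
    obtain ⟨M, ⟨e⟩⟩ := exists_iso_inDegreeZero hX
    rw [← K0.cls_eq_of_iso e, h.rank_inDegreeZero]
    exact_mod_cast h.pos M fun hM => hX' (((isZero_inDegreeZero_iff M).2 hM).of_iso e.symm)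
  cls_eq X hX := by
    obtain ⟨M, ⟨e⟩⟩ := exists_iso_inDegreeZero hX
    rw [← K0.cls_eq_of_iso e, h.rank_inDegreeZero]
    exact h.cls_inDegreeZero M
  exists_hom_ne_zero X Y hX hY hX' hY' := by
    obtain ⟨M, ⟨e⟩⟩ := exists_iso_inDegreeZero hX
    obtain ⟨N, ⟨e'⟩⟩ := exists_iso_inDegreeZero hY
    obtain ⟨p, hp⟩ := h.exists_epi M fun hM => hX'
      (((isZero_inDegreeZero_iff M).2 hM).of_iso e.symm)
    obtain ⟨i, hi⟩ := h.exists_mono N fun hN => hY'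
      (((isZero_inDegreeZero_iff N).2 hN).of_iso e'.symm)
    -- The composite `M ↠ k ↪ N` is nonzero because `k` is.
    let q : inDegreeZero M ⟶ inDegreeZero N :=
      ObjectProperty.homMk ((singleFunctor C 0).map (p ≫ i))
    refine ⟨e.inv ≫ q ≫ e'.hom, fun h0 => h.not_isZero ?_⟩
    have hq : q = 0 := by
      rw [← cancel_epi e.inv, ← cancel_mono e'.hom, Category.assoc, h0]
      simp
    have hpi : p ≫ i = 0 := (singleFunctor C 0).map_injective
      ((congrArg (fun f => Bounded.ι.map f) hq).trans ((singleFunctor C 0).map_zero _ _).symm)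
    have hi0 : i = 0 := by
      rw [← cancel_epi p, hpi, comp_zero]
    rw [IsZero.iff_id_eq_zero, ← cancel_mono i, hi0]
    simp
  finiteLength n := h.finiteLength_of_isEquivalence (toDegree C n).inv
  simple := h.simple_of_isEquivalence (toDegree C 0).inv
    ⟨(toDegree C 0).asEquivalence.unitIso.symm.app k⟩

end IsLocalLength

end Derived

open DerivedCategory

/-! ### Detecting maps on homology when all objects are projective. -/

section Homology

variable {C : Type u₁} [Category.{v₁} C] [Abelian C] [HasDerivedCategory.{w} C]

lemma from_singleFunctor_eq_zero_of_isLE {P : C} [Projective P] {X : DerivedCategory C} {n i : ℤ}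
    (hn : n < i) [X.IsLE n] (f : (singleFunctor C i).obj P ⟶ X) : f = 0 := by
  obtain ⟨L, _, ⟨e⟩⟩ := X.exists_iso_Q_obj_of_isLE n
  let e' := (singleFunctorIsoCompQ C i).app P
  have h := from_singleFunctor_obj_eq_zero_of_projective (e'.inv ≫ f ≫ e.hom) n hn
  rw [← cancel_epi e'.inv, ← cancel_mono e.hom, Category.assoc, h]
  simp

lemma singleFunctor_hom_eq_zero {M N : C} {n : ℤ}
    (f : (singleFunctor C n).obj M ⟶ (singleFunctor C n).obj N)
    (hf : (homologyFunctor C n).map f = 0) : f = 0 := by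
  obtain ⟨g, rfl⟩ := (singleFunctor C n).map_surjective f
  have h := NatIso.naturality_1 (singleFunctorCompHomologyFunctorIso C n) g
  have hg : g = 0 := by
    refine h.symm.trans ((congrArg (fun x => (singleFunctorCompHomologyFunctorIso C n).inv.app M ≫
      x ≫ (singleFunctorCompHomologyFunctorIso C n).hom.app N) hf).trans ?_)
    simp
  rw [hg, Functor.map_zero]

lemma exists_truncation_triangle (X : DerivedCategory C) (n : ℤ) :
    ∃ (L G : DerivedCategory C) (i : L ⟶ X) (p : X ⟶ G) (δ : G ⟶ L⟦(1 : ℤ)⟧),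
      Triangle.mk i p δ ∈ distTriang _ ∧ L.IsLE (n - 1) ∧ G.IsGE n ∧
      (∀ a, X.IsGE a → L.IsGE a) ∧ ∀ b, X.IsLE b → G.IsLE b := by
  let t : TStructure (DerivedCategory C) := TStructure.t
  exact ⟨_, _, _, _, _, t.triangleLTGE_distinguished n X, t.isLE_truncLT_obj X n (n - 1),
    t.isGE_truncGE_obj X n n, fun a _ => inferInstanceAs (t.IsGE ((t.truncLT n).obj X) a),
    fun b _ => inferInstanceAs (t.IsLE ((t.truncGE n).obj X) b)⟩

/-- Only the degree-`n` cohomology of `Y` matters: the part above is invisible by orthogonality of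
the t-structure, the part below by projectivity of `P`. -/
lemma from_singleFunctor_eq_zero {P : C} [Projective P] {n : ℤ} {Y : DerivedCategory C}
    (f : (singleFunctor C n).obj P ⟶ Y) (hf : (homologyFunctor C n).map f = 0) : f = 0 := by
  obtain ⟨L, G, i, p, δ, hT, hL, hG, -⟩ := exists_truncation_triangle Y (n + 1)
  rw [add_sub_cancel_right] at hL
  obtain ⟨f', hf'⟩ : ∃ f', f = f' ≫ i := Triangle.coyoneda_exact₂ _ hT f
    (TStructure.t.zero_of_isLE_of_isGE _ n (n + 1) (by lia) inferInstance hG)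
  have hmono : Mono ((homologyFunctor C n).map i) :=
    (HomologySequence.mono_homologyMap_mor₁_iff _ hT (n - 1) n).2
      ((G.isZero_of_isGE (n + 1) (n - 1) (by lia)).eq_of_src _ _)
  have hf₀ : (homologyFunctor C n).map f' = 0 := by
    rw [← cancel_mono ((homologyFunctor C n).map i), ← Functor.map_comp, ← hf', hf, zero_comp]
  obtain ⟨L', G', i', p', δ', hT', hL', hG', -, hG''⟩ := exists_truncation_triangle L n
  have := hG'' n hL
  obtain ⟨M, ⟨e⟩⟩ := exists_iso_singleFunctor_obj_of_isGE_of_isLE G' n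
  have h0 : f' ≫ p' ≫ e.hom = 0 :=
    singleFunctor_hom_eq_zero _ (by rw [Functor.map_comp, hf₀, zero_comp])
  have h0' : f' ≫ p' = 0 := by rw [← cancel_mono e.hom, zero_comp, ← h0, Category.assoc]
  obtain ⟨f'', hf''⟩ : ∃ f'', f' = f'' ≫ i' := Triangle.coyoneda_exact₂ _ hT' f' h0'
  rw [hf', hf'', from_singleFunctor_eq_zero_of_isLE (n := n - 1) (by lia) f'', zero_comp, zero_comp]

/-- Induction on the amplitude. Once `f` vanishes below the top degree, it factors through the top
cohomology, a projective in a single degree. -/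
lemma eq_zero_of_homologyFunctor_map_eq_zero (hC : ∀ P : C, Projective P) {X Y : DerivedCategory C}
    {a b : ℤ} [hXa : X.IsGE a] [hXb : X.IsLE b] (f : X ⟶ Y)
    (hf : ∀ n, (homologyFunctor C n).map f = 0) : f = 0 := by
  obtain ⟨N, hN⟩ : ∃ N : ℕ, b < a + N := ⟨(b - a + 1).toNat, by lia⟩
  induction N generalizing b X with
  | zero => exact IsZero.eq_of_src (TStructure.t.isZero X b a (by lia)) _ _
  | succ N ih =>
    obtain ⟨L, G, i, p, δ, hT, hL, hG, hL', hG'⟩ := exists_truncation_triangle X b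
    have := hL' a hXa
    have := hG' b hXb
    have hi : i ≫ f = 0 := ih (b := b - 1) (i ≫ f)
      (fun n => by rw [Functor.map_comp, hf, comp_zero]) (by lia)
    obtain ⟨f', hf'⟩ : ∃ f', f = p ≫ f' := Triangle.yoneda_exact₂ _ hT f hi
    obtain ⟨P, ⟨e⟩⟩ := exists_iso_singleFunctor_obj_of_isGE_of_isLE G b
    have : Projective P := hC P
    -- Surjectivity on `H^b` lets the vanishing of `f` on homology descend to `f'`.
    have hepi : Epi ((homologyFunctor C b).map p) :=
      (HomologySequence.epi_homologyMap_mor₂_iff _ hT b (b + 1)).2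
        ((L.isZero_of_isLE (b - 1) (b + 1) (by lia)).eq_of_tgt _ _)
    have hf₀ : (homologyFunctor C b).map f' = 0 := by
      rw [← cancel_epi ((homologyFunctor C b).map p), ← Functor.map_comp, ← hf', hf, comp_zero]
    have h0 : e.inv ≫ f' = 0 :=
      from_singleFunctor_eq_zero _ (by rw [Functor.map_comp, hf₀, comp_zero])
    rw [hf', ← e.hom_inv_id_assoc f', h0, comp_zero, comp_zero]

end Homology

/-! ### Derived functors of faithful exact functors. -/

section ExactFunctor

variable {C : Type u₁} [Category.{v₁} C] [Abelian C] [HasDerivedCategory.{w} C]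
  {C' : Type u₂} [Category.{v₂} C'] [Abelian C'] [HasDerivedCategory.{w'} C']
  (F : C ⥤ C') [F.Additive] [PreservesFiniteLimits F] [PreservesFiniteColimits F]

/-- An exact functor commutes with the homology of complexes. -/
def mapHomologicalComplexCompHomologyFunctorIso (n : ℤ) :
    F.mapHomologicalComplex (ComplexShape.up ℤ) ⋙ HomologicalComplex.homologyFunctor C' _ n ≅
      HomologicalComplex.homologyFunctor C (ComplexShape.up ℤ) n ⋙ F :=
  NatIso.ofComponents (fun K => (K.sc n).mapHomologyIso F) fun f =>
    ShortComplex.mapHomologyIso_hom_naturality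
      ((HomologicalComplex.shortComplexFunctor C (ComplexShape.up ℤ) n).map f) F

/-- The functor induced on derived categories by an exact functor commutes with homology. -/
def mapDerivedCategoryCompHomologyFunctorIso (n : ℤ) :
    F.mapDerivedCategory ⋙ homologyFunctor C' n ≅ homologyFunctor C n ⋙ F :=
  Localization.liftNatIso Q (HomologicalComplex.quasiIso C (ComplexShape.up ℤ))
    (Q ⋙ F.mapDerivedCategory ⋙ homologyFunctor C' n) (Q ⋙ homologyFunctor C n ⋙ F) _ _
    ((Functor.associator _ _ _).symm ≪≫ Functor.isoWhiskerRight F.mapDerivedCategoryFactors _ ≪≫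
      Functor.associator _ _ _ ≪≫ Functor.isoWhiskerLeft _ (homologyFunctorFactors C' n) ≪≫
      mapHomologicalComplexCompHomologyFunctorIso F n ≪≫
      Functor.isoWhiskerRight (homologyFunctorFactors C n).symm F ≪≫ Functor.associator _ _ _)

variable [F.Faithful]

lemma isZero_homology_mapDerivedCategory_iff (X : DerivedCategory C) (n : ℤ) :
    IsZero ((homologyFunctor C' n).obj (F.mapDerivedCategory.obj X)) ↔
      IsZero ((homologyFunctor C n).obj X) := by
  refine ((mapDerivedCategoryCompHomologyFunctorIso F n).app X).isZero_iff.trans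
    ⟨fun h => ?_, fun h => F.map_isZero h⟩
  rw [IsZero.iff_id_eq_zero]
  exact F.map_injective (h.eq_of_src _ _)

/-- An exact functor commutes with homology, and a faithful one detects its vanishing; degrees are
defined by that vanishing. -/
theorem isCompatible_mapDb {k : C} {k' : C'} (e : F.obj k ≅ k') :
    IsLocalHeart.IsCompatible (mapDb F) (tBounded C) (inDegreeZero k) (tBounded C')
      (inDegreeZero k') where
  isLE_iff X n := by
    rw [tBounded_isLE_iff, tBounded_isLE_iff, DerivedCategory.isLE_iff, DerivedCategory.isLE_iff]
    exact forall₂_congr fun i _ => isZero_homology_mapDerivedCategory_iff F X.obj i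
  isGE_iff X n := by
    rw [tBounded_isGE_iff, tBounded_isGE_iff, DerivedCategory.isGE_iff, DerivedCategory.isGE_iff]
    exact forall₂_congr fun i _ => isZero_homology_mapDerivedCategory_iff F X.obj i
  nonempty_iso := ⟨ObjectProperty.isoMk _ ((F.mapDerivedCategorySingleFunctor 0).app k ≪≫
    (singleFunctor C' 0).mapIso e)⟩

theorem satisfiesInd_mapDb (hC : ∀ P : C, Projective P) : SatisfiesInd (mapDb F) := by
  intro a b h g
  obtain ⟨⟨m, hm⟩, ⟨n, hn⟩⟩ := a.property
  -- The hypothesis is used only for the image of `g`: what is shown below is that the functor is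
  -- faithful.
  have hg : F.mapDerivedCategory.map g.hom = 0 :=
    congrArg (fun f => f.hom) (h ((mapDb F).map g))
  refine ObjectProperty.hom_ext _ (eq_zero_of_homologyFunctor_map_eq_zero hC (a := m) (b := n) _
    fun i => F.map_injective ?_)
  have h1 := NatIso.naturality_1 (mapDerivedCategoryCompHomologyFunctorIso F i) g.hom
  rw [Functor.map_zero]
  refine h1.symm.trans ((congrArg (fun x => _ ≫ (homologyFunctor C' i).map x ≫ _) hg).trans ?_)
  simp

end ExactFunctor

/-! ### Finitely generated modules over an Artinian local ring. -/

section Rings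

variable (R : Type u) [CommRing R] [IsLocalRing R]

/-- Simple modules are quotients by maximal ideals, and a local ring has only one. -/
lemma nonempty_linearEquiv_of_isSimpleModule (M N : Type*) [AddCommGroup M] [Module R M]
    [AddCommGroup N] [Module R N] [hM : IsSimpleModule R M] [hN : IsSimpleModule R N] :
    Nonempty (M ≃ₗ[R] N) := by
  obtain ⟨I, hI, ⟨e⟩⟩ := isSimpleModule_iff_quot_maximal.1 hM
  obtain ⟨J, hJ, ⟨e'⟩⟩ := isSimpleModule_iff_quot_maximal.1 hN
  obtain rfl := (IsLocalRing.eq_maximalIdeal hI).trans (IsLocalRing.eq_maximalIdeal hJ).symm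
  exact ⟨e.trans e'.symm⟩

instance : (residueRestrict R).Faithful :=
  have : (residueRestrict R ⋙ (ModuleCat.isFG.{u} R).ι).Faithful :=
    inferInstanceAs (((ModuleCat.isFG.{u} (IsLocalRing.ResidueField R)).ι ⋙
      ModuleCat.restrictScalars.{u} (IsLocalRing.residue R)).Faithful)
  Functor.Faithful.of_comp _ (ModuleCat.isFG.{u} R).ι

lemma nontrivial_of_not_isZero {A : Type u} [CommRing A] [IsNoetherianRing A]
    {X : FGModuleCat.{u} A} (hX : ¬ IsZero X) :
    Nontrivial X := by
  by_contra h
  rw [not_nontrivial_iff_subsingleton] at h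
  refine hX ((IsZero.iff_id_eq_zero X).2 ?_)
  ext x
  exact Subsingleton.elim (α := X) _ _

variable [IsArtinianRing R]

instance (M : FGModuleCat.{u} R) : IsArtinian R M := inferInstance

instance (M : FGModuleCat.{u} R) : IsNoetherian R M := inferInstance

/-- The length of finitely generated modules over an Artinian local ring. -/
theorem isLocalLength_FGModuleCat (K : Type u) [AddCommGroup K] [Module R K] [Module.Finite R K]
    [IsSimpleModule R K] :
    IsLocalLength (FGModuleCat.of R K) fun M => (Module.length R M).toNat where
  add S hS := by
    have h := hS.map_of_exact (forget₂ (FGModuleCat.{u} R) (ModuleCat.{u} R))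
    have := Module.length_eq_add_of_exact (R := R) (M := S.X₂) (N := S.X₁) (P := S.X₃)
      S.f.hom.hom S.g.hom.hom h.moduleCat_injective_f h.moduleCat_surjective_g
      ((ShortComplex.ShortExact.moduleCat_exact_iff_function_exact _).1 h.exact)
    rw [this, ENat.toNat_add Module.length_ne_top Module.length_ne_top]
  pos X hX := by
    have := nontrivial_of_not_isZero hX
    rw [Nat.pos_iff_ne_zero, Ne, ENat.toNat_eq_zero, not_or]
    exact ⟨Module.length_pos.ne', Module.length_ne_top⟩
  eq_one := by
    have : Module.length R (FGModuleCat.of R K) = 1 := Module.length_eq_one R K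
    rw [this]
    rfl
  exists_epi X hX := by
    have := nontrivial_of_not_isZero hX
    obtain ⟨N, hN, -⟩ := (eq_top_or_exists_le_coatom (⊥ : Submodule R X)).resolve_left bot_ne_top
    have : IsSimpleModule R (X ⧸ N) := isSimpleModule_iff_isCoatom.2 hN
    obtain ⟨e⟩ := nonempty_linearEquiv_of_isSimpleModule R (X ⧸ N) K
    let f : X ⟶ FGModuleCat.of R K := FGModuleCat.ofHom (e.toLinearMap ∘ₗ N.mkQ)
    have hf : Epi ((forget₂ (FGModuleCat.{u} R) (ModuleCat.{u} R)).map f) :=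
      (ModuleCat.epi_iff_surjective _).2 (e.surjective.comp N.mkQ_surjective)
    exact ⟨f, (forget₂ (FGModuleCat.{u} R) (ModuleCat.{u} R)).epi_of_epi_map hf⟩
  exists_mono X hX := by
    have := nontrivial_of_not_isZero hX
    obtain ⟨N, hN⟩ := IsAtomic.exists_atom (Submodule R X)
    have : IsSimpleModule R N := isSimpleModule_iff_isAtom.2 hN
    obtain ⟨e⟩ := nonempty_linearEquiv_of_isSimpleModule R K N
    let f : FGModuleCat.of R K ⟶ X := FGModuleCat.ofHom (N.subtype ∘ₗ e.toLinearMap)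
    have hf : Mono ((forget₂ (FGModuleCat.{u} R) (ModuleCat.{u} R)).map f) :=
      (ModuleCat.mono_iff_injective _).2 (N.subtype_injective.comp e.injective)
    exact ⟨f, (forget₂ (FGModuleCat.{u} R) (ModuleCat.{u} R)).mono_of_mono_map hf⟩

instance : IsSimpleModule R (IsLocalRing.ResidueField R) :=
  isSimpleModule_iff_quot_maximal.2
    ⟨IsLocalRing.maximalIdeal R, inferInstance, ⟨LinearEquiv.refl _ _⟩⟩

omit [IsArtinianRing R] in
lemma projective_FGModuleCat_of_field (K : Type u) [Field K] (P : FGModuleCat.{u} K) :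
    Projective P where
  factors {E X} f e _ := by
    have he : Epi ((forget₂ (FGModuleCat.{u} K) (ModuleCat.{u} K)).map e) := inferInstance
    have : Projective (P.obj : ModuleCat.{u} K) :=
      ModuleCat.projective_of_categoryTheory_projective P.obj
    let g := Projective.factorThru
      ((forget₂ (FGModuleCat.{u} K) (ModuleCat.{u} K)).map f)
      ((forget₂ (FGModuleCat.{u} K) (ModuleCat.{u} K)).map e)
    exact ⟨(forget₂ (FGModuleCat.{u} K) (ModuleCat.{u} K)).preimage g,
      (forget₂ (FGModuleCat.{u} K) (ModuleCat.{u} K)).map_injective (by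
        rw [Functor.map_comp, Functor.map_preimage]
        exact Projective.factorThru_comp _ _)⟩

/-- The residue field, seen as a module over itself, restricts to the residue field as
an `R`-module. -/
def residueRestrictIso :
    (residueRestrict R).obj (FGModuleCat.of (IsLocalRing.ResidueField R)
      (IsLocalRing.ResidueField R)) ≅ FGModuleCat.of R (IsLocalRing.ResidueField R) :=
  let e : (ModuleCat.restrictScalars.{u} (IsLocalRing.residue R)).obj
      (ModuleCat.of (IsLocalRing.ResidueField R) (IsLocalRing.ResidueField R)) ≃ₗ[R]
        IsLocalRing.ResidueField R :=
    { AddEquiv.refl (IsLocalRing.ResidueField R) with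
      map_smul' := fun r x => (Algebra.smul_def r (show IsLocalRing.ResidueField R from x)).symm }
  ObjectProperty.isoMk _ e.toModuleIso

end Rings

end Stability

end

theorem proposition1p1 (R : Type u) [CommRing R] [IsLocalRing R] [IsArtinianRing R]
    [HasDerivedCategory.{w} (FGModuleCat.{u} R)]
    [HasDerivedCategory.{w'} (FGModuleCat.{u} (IsLocalRing.ResidueField R))] :
    -- the residue field is stable for every stability condition
    (∀ σ : Stab (Db R), σ.IsStable (residueFieldObj R)) ∧
    Nonempty (Stab (Db R)) ∧
    -- `j_*⁻¹` is defined on all of `Stab (D^b(R))`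
    SatisfiesInd (jPushforward R) ∧
    Dom (jPushforward R) = Set.univ ∧
    -- the spaces are complex manifolds, and `j_*⁻¹` is an isomorphism between them
    Nonempty (PeriodCoordinates (Db R)) ∧
    Nonempty (PeriodCoordinates (Db (IsLocalRing.ResidueField R))) ∧
    ∃ Φ : Stab (Db R) ≃ₜ Stab (Db (IsLocalRing.ResidueField R)),
      (∀ σ : Dom (jPushforward R), Φ σ = inducedMap (jPushforward R) σ) ∧
      ∀ (c : PeriodCoordinates (Db R))
        (c' : PeriodCoordinates (Db (IsLocalRing.ResidueField R))),
        IsBiholomorphic c c' Φ := by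
  have h' := (isLocalLength_FGModuleCat R (IsLocalRing.ResidueField R)).isLocalHeart
  -- The residue field is itself an Artinian local ring, and it is simple as a module over itself.
  have h := (isLocalLength_FGModuleCat (IsLocalRing.ResidueField R)
    (IsLocalRing.ResidueField R)).isLocalHeart
  have hF := isCompatible_mapDb (residueRestrict R) (residueRestrictIso R)
  exact ⟨h'.isStable, ⟨h'.stab 0⟩,
    satisfiesInd_mapDb _ (projective_FGModuleCat_of_field _),
    h.dom_eq_univ h' hF, ⟨h'.periodCoordinates⟩, ⟨h.periodCoordinates⟩,
    h.stabHomeomorphOfCompatible h', h.stabHomeomorphOfCompatible_apply h' hF,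
    h.isBiholomorphic h'⟩
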